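/- Let $S$ be a Noetherian integrally closed domain whose field of fractions $L$ has characteristic $0$. Let $p\in\mathbb Z$ be a prime number such that $p$ is a prime element of $S$ and $S/pS$ is integrally closed. Call $x\in S$ square free if $QS_Q=xS_Q$ for every height one prime $Q$ of $S$ containing $x$. Let $f,g\in S$ be square free elements that are not $p$-th powers in $S$ and such that, if $f\neq g$, no height one prime of $S$ contains both $f$ and $g$. Let $K=L(\omega,\mu)$ be a field extension of $L$ with $\omega^p=f$ and $\mu^p=g$, and assume that the polynomial $U^p-g$ is irreducible over $L(\omega)$. Put $A:=S[\omega,\mu]\subseteq K$. For a commutative ring $R$ let $R^p\subseteq R$ be the preimage under $R\to R/pR$ of $\{x^p: x\in R/pR\}$, and let $R^{p\wedge p^2}:=\{x^p+y\,p^2: x,y\in R\}$. Then: 1. There is a unique height one prime $P\subseteq A$ containing $p$. 2. $A$ is integrally closed if and only if $A_P$ is a discrete valuation ring. 3. If $f\notin S^p$, then $pS[\omega]$ is a prime ideal of $S[\omega]$; if $g\notin S^p$, then $pS[\mu]$ is a prime ideal of $S[\mu]$. The ring $A$ is integrally closed if and only if at least one of the following holds: - $f\notin S^p$ and $g\notin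 \big(S[\omega]_{(p)}\big)^{p\wedge p^2}$; - $g\notin S^p$ and $f\notin \big(S[\mu]_{(p)}\big)^{p\wedge p^2}$. -/

import Mathlib

/-- The ideal `pR` generated by the integer `p` in a commutative ring `R`. -/
abbrev pIdeal (p : ℕ) (R : Type*) [CommRing R] : Ideal R := Ideal.span {(p : R)}

/-- `R^p`: the preimage in `R` of the image of the Frobenius map `x ↦ x ^ p` of `R / pR`. -/
def frobLift (p : ℕ) (R : Type*) [CommRing R] : Set R :=
  {s | ∃ x : R ⧸ pIdeal p R, x ^ p = Ideal.Quotient.mk (pIdeal p R) s}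

/-- `R^{p^k ∧ p^n}`: the elements of `R` of the form `x ^ (p ^ k) + y * p ^ n` with `x, y ∈ R`. -/
def powWedge (p k n : ℕ) (R : Type*) [CommRing R] : Set R :=
  {s | ∃ x y : R, s = x ^ (p ^ k) + y * (p : R) ^ n}

/-- `x` is square free: `Q S_Q = x S_Q` for every height one prime `Q` of `S` containing `x`. -/
def IsSqFreeElem {S : Type*} [CommRing S] (x : S) : Prop :=
  ∀ (Q : Ideal S) [Q.IsPrime], Q.height = 1 → x ∈ Q →
    Q.map (algebraMap S (Localization.AtPrime Q)) =
      Ideal.span {algebraMap S (Localization.AtPrime Q) x}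

/-- No two distinct elements of `W` lie in a common height one prime of `S`. -/
def SatisfiesA1 {S : Type*} [CommRing S] (W : Set S) : Prop :=
  ∀ x ∈ W, ∀ y ∈ W, x ≠ y → ¬ ∃ Q : Ideal S, Q.IsPrime ∧ Q.height = 1 ∧ x ∈ Q ∧ y ∈ Q

open Polynomial

/-! The monomials `ω ^ i * μ ^ j` with `i, j < p` form an `S`-basis of `A`, and traces bound the
denominators of integral elements by `p ^ 2 * f * g` (`isIntegral_coord_of_isIntegral`). Since `S`
is the intersection of its localizations at height one primes, membership in `A` is tested
coordinatewise at those primes. At a prime containing `f` but not `p`, `ω` satisfies an Eisenstein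
equation and `g` is a unit, so nothing is missing; likewise for `g`. Only `(p)` remains: `A` is
normal iff it is `p`-saturated in its integral closure (`isIntegrallyClosed_iff_saturated`).

Modulo `p`, the `p`-th power of any element of `A` comes from `S`. So the radical of `pA` is prime
and is the only height one prime `P` over `p`, and a denominator outside `P` can be replaced by an
element of `S` prime to `p`; hence normality of `A_P` already gives saturation.

For the criterion, let `f ∉ S^p`. Then `p` is prime in `T = S[ω]`. If `g` is not a `p`-th power in
`Frac(T/pT)`, the powers of `μ` are independent modulo `p`. Otherwise `s ^ p * g = c ^ p - p * d`,
and if `p ∤ d` the element `s * μ - c` is Eisenstein at `p` (`saturated`). Conversely, explicit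
integral elements outside `A` appear when `p ∣ d`, or when `f` and `g` are both `p`-th powers modulo
`p` (`not_saturated_of_pow_add_sq`, `not_saturated_of_pow_add`). -/

theorem exists_sum_pow_prime_eq {R ι : Type*} [CommRing R] {p : ℕ} (hp : p.Prime)
    (s : Finset ι) (x : ι → R) : ∃ r, (∑ i ∈ s, x i) ^ p = ∑ i ∈ s, x i ^ p + p * r := by
  classical
  induction s using Finset.induction_on with
  | empty => exact ⟨0, by simp [hp.ne_zero]⟩
  | insert a s ha ih =>
    obtain ⟨r, hr⟩ := ih
    obtain ⟨r', hr'⟩ := exists_add_pow_prime_eq hp (x a) (∑ i ∈ s, x i)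
    refine ⟨r + x a * (∑ i ∈ s, x i) * r', ?_⟩
    rw [Finset.sum_insert ha, Finset.sum_insert ha, hr', hr]
    ring

theorem mem_frobLift_iff {R : Type*} [CommRing R] {p : ℕ} {s : R} :
    s ∈ frobLift p R ↔ ∃ x : R, (p : R) ∣ s - x ^ p := by
  constructor
  · rintro ⟨x, hx⟩
    obtain ⟨x, rfl⟩ := Ideal.Quotient.mk_surjective x
    refine ⟨x, ?_⟩
    rw [← map_pow, eq_comm, Ideal.Quotient.eq] at hx
    exact Ideal.mem_span_singleton.1 hx
  · rintro ⟨x, hx⟩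
    refine ⟨Ideal.Quotient.mk _ x, ?_⟩
    rw [← map_pow, eq_comm, Ideal.Quotient.eq]
    exact Ideal.mem_span_singleton.2 hx

/-! ### Two criteria for divisibility of coefficients -/

/-- If `γ` is not a `p`-th power in the fraction field of a domain `κ` of characteristic `p`,
then `1, γ, …, γ ^ (p - 1)` are linearly independent over the `p`-th powers. -/
theorem eq_zero_of_sum_pow_mul_pow_eq_zero {κ : Type*} [CommRing κ] [IsDomain κ] {p : ℕ}
    (hp : p.Prime) [CharP κ p] {γ : κ} (hγ : ∀ a b : κ, a ^ p = γ * b ^ p → b = 0)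
    (β : Fin p → κ) (h : ∑ j, β j ^ p * γ ^ (j : ℕ) = 0) (j : Fin p) : β j = 0 := by
  let k := FractionRing κ
  have hinj : Function.Injective (algebraMap κ k) := IsFractionRing.injective κ k
  have hirr : Irreducible (X ^ p - C (algebraMap κ k γ)) := by
    refine X_pow_sub_C_irreducible_of_prime hp fun x hx => ?_
    obtain ⟨a, b, hb, rfl⟩ := IsFractionRing.div_surjective (A := κ) x
    have hb0 : b ≠ 0 := nonZeroDivisors.ne_zero hb
    have hb' : algebraMap κ k b ≠ 0 := fun h0 => hb0 (hinj (by simpa using h0))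
    refine hb0 (hγ a b (hinj ?_))
    rw [div_pow, div_eq_iff (pow_ne_zero _ hb')] at hx
    simpa using hx
  have := Fact.mk hirr
  let E := AdjoinRoot (X ^ p - C (algebraMap κ k γ))
  have : CharP k p := charP_of_injective_algebraMap hinj p
  have : CharP E p := charP_of_injective_algebraMap (algebraMap k E).injective p
  have : Fact p.Prime := ⟨hp⟩
  let P : k[X] := ∑ j : Fin p, C (algebraMap κ k (β j)) * X ^ (j : ℕ)
  have hroot : (AdjoinRoot.root (X ^ p - C (algebraMap κ k γ))) ^ p =
      AdjoinRoot.of _ (algebraMap κ k γ) := by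
    have := AdjoinRoot.eval₂_root (X ^ p - C (algebraMap κ k γ))
    rw [eval₂_sub, eval₂_C, eval₂_pow, eval₂_X] at this
    exact sub_eq_zero.1 this
  have hP : AdjoinRoot.mk (X ^ p - C (algebraMap κ k γ)) P = 0 := by
    -- In the field `E` of characteristic `p`, the `p`-th power of the value of `P` at the root is
    -- the given vanishing sum.
    refine eq_zero_of_pow_eq_zero (n := p) ?_
    simp only [P, map_sum, map_mul, map_pow, AdjoinRoot.mk_C, AdjoinRoot.mk_X]
    rw [sum_pow_char p]
    have := congrArg (fun x => AdjoinRoot.of (X ^ p - C (algebraMap κ k γ)) (algebraMap κ k x)) h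
    simp only [map_sum, map_mul, map_pow, map_zero] at this
    rw [← this]
    refine Finset.sum_congr rfl fun j _ => ?_
    rw [mul_pow, ← pow_mul, mul_comm (j : ℕ), pow_mul, hroot]
  rw [AdjoinRoot.mk_eq_zero] at hP
  have hdeg : P.degree < (X ^ p - C (algebraMap κ k γ)).degree := by
    rw [degree_X_pow_sub_C hp.pos]
    refine (degree_sum_le _ _).trans_lt ((Finset.sup_lt_iff (WithBot.bot_lt_coe p)).2 fun j _ => ?_)
    exact (degree_C_mul_X_pow_le _ _).trans_lt (Nat.cast_lt.2 j.2)
  have hP0 : P = 0 := eq_zero_of_dvd_of_degree_lt hP hdeg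
  have hc := congrArg (fun q => coeff q (j : ℕ)) hP0
  simp only [P, finsetSum_coeff, coeff_C_mul, coeff_X_pow, coeff_zero] at hc
  rw [Finset.sum_eq_single j (fun i _ hij => by simp [Fin.val_inj, hij.symm]) (by simp)] at hc
  exact hinj (by simpa using hc)

/-- Coefficients of `∑ bⱼ μ ^ j`, `μ ^ p = γ`, are divisible by `p` if the `p`-th power of the sum
is, when `γ` is not a `p`-th power modulo `p`, up to denominators. -/
theorem dvd_of_dvd_sum_of_not_pow {R B : Type*} [CommRing R] [CommRing B] {p : ℕ}
    (hp : p.Prime) (hpR : Prime (p : R)) (φ : R →+* B)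
    (hφ : ∀ r : R, (p : B) ∣ φ r → (p : R) ∣ r) {γ : R}
    (hγ : ∀ a b : R, (p : R) ∣ a ^ p - γ * b ^ p → (p : R) ∣ b) {μ : B} (hμ : μ ^ p = φ γ)
    (b : Fin p → R) (h : (p : B) ∣ (∑ j, φ (b j) * μ ^ (j : ℕ)) ^ p)
    (j : Fin p) : (p : R) ∣ b j := by
  have : Fact p.Prime := ⟨hp⟩
  have hprime : (Ideal.span {(p : R)}).IsPrime := (Ideal.span_singleton_prime hpR.ne_zero).2 hpR
  have : CharP (R ⧸ Ideal.span {(p : R)}) p := CharP.quotient R p hpR.not_isUnit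
  obtain ⟨r, hr⟩ := exists_sum_pow_prime_eq hp Finset.univ (fun j => φ (b j) * μ ^ (j : ℕ))
  have h1 : (p : B) ∣ φ (∑ j, b j ^ p * γ ^ (j : ℕ)) := by
    have h2 : (p : B) ∣ (∑ j, φ (b j) * μ ^ (j : ℕ)) ^ p - p * r :=
      dvd_sub h (dvd_mul_right _ _)
    rw [hr, add_sub_cancel_right] at h2
    convert h2 using 1
    simp only [map_sum, map_mul, map_pow]
    refine Finset.sum_congr rfl fun j _ => ?_
    rw [mul_pow, ← pow_mul, mul_comm (j : ℕ), pow_mul, hμ]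
  have h3 := hφ _ h1
  rw [← Ideal.mem_span_singleton, ← Ideal.Quotient.eq_zero_iff_mem] at h3 ⊢
  refine eq_zero_of_sum_pow_mul_pow_eq_zero hp (γ := Ideal.Quotient.mk _ γ) ?_
    (fun j => Ideal.Quotient.mk _ (b j)) (by simpa using h3) j
  intro x y hxy
  obtain ⟨x, rfl⟩ := Ideal.Quotient.mk_surjective x
  obtain ⟨y, rfl⟩ := Ideal.Quotient.mk_surjective y
  rw [Ideal.Quotient.eq_zero_iff_mem, Ideal.mem_span_singleton]
  refine hγ x y ?_
  rw [← Ideal.mem_span_singleton, ← Ideal.Quotient.eq]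
  simpa using hxy

/-- Coefficients of `∑ bⱼ z ^ j` lie in a prime `q` if the sum is divisible by a local
uniformizer `π` at `q` and `z` satisfies an Eisenstein equation at `q`. -/
theorem mem_of_dvd_sum_of_eisenstein {R B : Type*} [CommRing R] [CommRing B] [IsDomain B] {n : ℕ}
    (φ : R →+* B) (q : Ideal R) [q.IsPrime] {π : R} (hπ0 : φ π ≠ 0)
    (hπ : ∀ r ∈ q, ∃ t ∉ q, π ∣ t * r) (hφ : ∀ r : R, φ π ∣ φ r → r ∈ q)
    {z y : B} {d : R} (hd : d ∉ q) (hz : z ^ n = φ π * (φ d + z * y))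
    (b : Fin n → R) (h : φ π ∣ ∑ j, φ (b j) * z ^ (j : ℕ)) (j : Fin n) : b j ∈ q := by
  obtain ⟨j, hj⟩ := j
  induction j using Nat.strong_induction_on with | _ j ih
  have hlt : ∀ l : Fin n, ∃ t ∉ q, (l : ℕ) < j → π ∣ t * b l := by
    intro l
    by_cases hl : (l : ℕ) < j
    · obtain ⟨t, ht, ht'⟩ := hπ _ (ih l hl l.2)
      exact ⟨t, ht, fun _ => ht'⟩
    -- For `l ≥ j` no multiplier is needed; `1` keeps the product of all `t l` outside `q`.
    · exact ⟨1, fun h1 => Ideal.IsPrime.ne_top' ((Ideal.eq_top_iff_one q).2 h1), fun h => absurd h hl⟩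
  choose t ht htb using hlt
  have hzn : φ π ∣ z ^ n := ⟨_, hz⟩
  have hT : ∏ l, t l ∉ q := fun hmem => by
    obtain ⟨l, -, hl⟩ := Ideal.IsPrime.prod_mem_iff.1 hmem
    exact ht l hl
  -- The factor `z ^ (n - 1 - j)` raises every term above `j` to a multiple of `z ^ n`, hence of
  -- `π`; the product of the `t l` handles the terms below `j`. Only the term `j`, now with `z ^ (n
  -- - 1)`, survives modulo `π`.
  have hsum := dvd_mul_of_dvd_right h (φ (∏ l, t l) * z ^ (n - 1 - j))
  rw [Finset.mul_sum, ← Finset.add_sum_erase _ _ (Finset.mem_univ (⟨j, hj⟩ : Fin n))] at hsum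
  have hrest : φ π ∣ ∑ l ∈ Finset.univ.erase (⟨j, hj⟩ : Fin n),
      φ (∏ l, t l) * z ^ (n - 1 - j) * (φ (b l) * z ^ (l : ℕ)) := by
    refine Finset.dvd_sum fun l hl => ?_
    have hne : (l : ℕ) ≠ j := fun h => (Finset.mem_erase.1 hl).1 (Fin.ext h)
    rcases lt_or_gt_of_ne hne with hlj | hlj
    · have h1 : π ∣ (∏ l, t l) * b l :=
        (htb l hlj).trans (mul_dvd_mul_right (Finset.dvd_prod_of_mem t (Finset.mem_univ l)) _)
      have h2 := map_dvd φ h1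
      rw [map_mul] at h2
      rw [show φ (∏ l, t l) * z ^ (n - 1 - j) * (φ (b l) * z ^ (l : ℕ)) =
        φ (∏ l, t l) * φ (b l) * (z ^ (n - 1 - j) * z ^ (l : ℕ)) by ring]
      exact dvd_mul_of_dvd_left h2 _
    · have h3 : z ^ (n - 1 - j) * z ^ (l : ℕ) = z ^ n * z ^ ((l : ℕ) - 1 - j) := by
        rw [← pow_add, ← pow_add]
        congr 1
        omega
      rw [show φ (∏ l, t l) * z ^ (n - 1 - j) * (φ (b l) * z ^ (l : ℕ)) =
        (z ^ (n - 1 - j) * z ^ (l : ℕ)) * (φ (∏ l, t l) * φ (b l)) by ring, h3, mul_assoc]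
      exact dvd_mul_of_dvd_left hzn _
  obtain ⟨x, hx⟩ := (dvd_add_left hrest).1 hsum
  have hexp : z ^ (n - 1 - j) * z ^ j * z = z ^ n := by
    rw [← pow_add, ← pow_succ]
    congr 1
    omega
  -- One more factor `z` produces `z ^ n`, and the Eisenstein equation lets `π` be cancelled.
  have h4 : φ (∏ l, t l) * φ (b ⟨j, hj⟩) * φ d =
      z * (x - φ (∏ l, t l) * φ (b ⟨j, hj⟩) * y) := by
    refine mul_left_cancel₀ hπ0 ?_
    linear_combination (-φ (∏ l, t l) * φ (b ⟨j, hj⟩)) * hz + z * hx -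
      φ (∏ l, t l) * φ (b ⟨j, hj⟩) * hexp
  have h5 : ((∏ l, t l) * b ⟨j, hj⟩ * d) ^ n ∈ q := by
    refine hφ _ ?_
    rw [map_pow, map_mul, map_mul, h4, mul_pow]
    exact dvd_mul_of_dvd_left hzn _
  have h6 := Ideal.IsPrime.mem_of_pow_mem inferInstance n h5
  exact ((Ideal.IsPrime.mem_or_mem inferInstance
    ((Ideal.IsPrime.mem_or_mem inferInstance h6).resolve_right hd)).resolve_left hT)

/-! ### Normal Noetherian domains in height one -/

/-- An element of the fraction field of a Noetherian integrally closed domain that is integral at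
every height one prime is integral. -/
theorem exists_algebraMap_eq_of_forall_height_one {S L : Type*} [CommRing S] [IsDomain S]
    [IsNoetherianRing S] [IsIntegrallyClosed S] [Field L] [Algebra S L] [IsFractionRing S L] (c : L)
    (hc : ∀ q : Ideal S, q.IsPrime → q.height = 1 → ∃ t ∉ q, ∃ s, algebraMap S L s = t • c) :
    ∃ s, algebraMap S L s = c := by
  let N : Submodule S L := LinearMap.range (Algebra.linearMap S L)
  by_contra hcS
  have hc0 : N.mkQ c ≠ 0 := by
    rw [Ne, Submodule.mkQ_apply, Submodule.Quotient.mk_eq_zero]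
    exact hcS
  obtain ⟨q, hq, hle⟩ := exists_le_isAssociatedPrime_of_isNoetherianRing S _ hc0
  obtain ⟨hq, x, hx⟩ := Submodule.isAssociatedPrime_iff.1 hq
  obtain ⟨c', rfl⟩ := N.mkQ_surjective x
  have hcolon : ∀ (r : S) (y : L), r ∈ (⊥ : Submodule S (L ⧸ N)).colon {N.mkQ y} ↔
      ∃ s, algebraMap S L s = r • y := by
    intro r y
    rw [Submodule.mem_colon_singleton, Submodule.mem_bot, ← map_smul, Submodule.mkQ_apply,
      Submodule.Quotient.mk_eq_zero]
    rfl
  have hmem : ∀ r, r ∈ q ↔ ∃ s, algebraMap S L s = r • c' := fun r => hx ▸ hcolon r c'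
  have hinj : Function.Injective (algebraMap S L) := IsFractionRing.injective S L
  have hq0 : q ≠ ⊥ := by
    obtain ⟨a, b, hb, hab⟩ := IsFractionRing.div_surjective (A := S) c'
    have hb0 : b ≠ 0 := nonZeroDivisors.ne_zero hb
    have hb' : algebraMap S L b ≠ 0 := fun h0 => hb0 (hinj (by simpa using h0))
    refine fun h0 => hb0 ((Submodule.mem_bot S).1 (h0 ▸ (hmem b).2 ⟨a, ?_⟩))
    rw [← hab, Algebra.smul_def, mul_div_cancel₀ _ hb']
  -- Otherwise `q * c' ⊆ q` with `q` nonzero and finitely generated, so `c'` is integral by the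
  -- determinant trick and lies in `S`, contradicting `1 ∉ q`.
  obtain ⟨t, ht, u, hu, htu⟩ : ∃ t ∈ q, ∃ u, u ∉ q ∧ algebraMap S L u = t • c' := by
    by_contra! hcon
    have hint : IsIntegral S c' := by
      refine isIntegral_of_smul_mem_submodule (Submodule.map (Algebra.linearMap S L) q) ?_
        (Submodule.FG.map _ (IsNoetherian.noetherian q)) c' ?_
      · rw [Ne, ← Submodule.map_bot (Algebra.linearMap S L)]
        exact fun h => hq0 (Submodule.map_injective_of_injective hinj h)
      · rintro _ ⟨t, ht, rfl⟩
        obtain ⟨s, hs⟩ := (hmem t).1 ht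
        refine ⟨s, by_contra fun hsq => hcon t ht s hsq hs, ?_⟩
        rw [Algebra.linearMap_apply, Algebra.linearMap_apply, hs, Algebra.smul_def, smul_eq_mul,
          mul_comm]
    obtain ⟨s, hs⟩ := IsIntegrallyClosed.isIntegral_iff.1 hint
    refine hq.ne_top ((Ideal.eq_top_iff_one q).2 ((hmem 1).2 ⟨s, by rw [hs, one_smul]⟩))
  have ht0 : t ≠ 0 := by
    rintro rfl
    rw [zero_smul] at htu
    exact hu (by rw [hinj (htu.trans (map_zero _).symm)]; exact zero_mem _)
  -- For `r ∈ q` with `r * c' = s` one has `r * u = t * s`; a prime inside `q` containing `t` omits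
  -- `u`, so it contains `r`. Krull's theorem then bounds the height of `q`.
  have hmin : q ∈ (Ideal.span {t}).minimalPrimes := by
    refine ⟨⟨hq, (Ideal.span_singleton_le_iff_mem _).2 ht⟩, fun q' hq' hle' r hr => ?_⟩
    obtain ⟨s, hs⟩ := (hmem r).1 hr
    have : r * u = t * s := hinj (by
      rw [map_mul, map_mul, htu, hs, Algebra.smul_def, Algebra.smul_def]; ring)
    refine (hq'.1.mem_or_mem (x := r) (y := u) ?_).resolve_right fun h => hu (hle' h)
    rw [this]
    exact q'.mul_mem_right _ (hq'.2 (Ideal.mem_span_singleton_self t))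
  have hh : q.height = 1 := by
    refine le_antisymm (Ideal.height_le_one_of_isPrincipal_of_mem_minimalPrimes _ q hmin) ?_
    rw [Order.one_le_iff_ne_zero, Ne, Ideal.height_eq_zero_iff_eq_bot]
    exact hq0
  obtain ⟨r, hr, s, hs⟩ := hc q hq hh
  exact hr (hle ((hcolon r c).2 ⟨s, hs⟩))

/-! ### Traces and bases of radical extensions -/

/-- Multiplication by `μ ^ m` sends each basis vector to a multiple of a different one, so its
matrix has zero diagonal. -/
theorem trace_pow_eq_zero {F K : Type*} [Field F] [Field K] [Algebra F K] {n : ℕ} {μ : K} {g : F}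
    (b : Module.Basis (Fin n) F K) (hb : ∀ j, b j = μ ^ (j : ℕ)) (hμ : μ ^ n = algebraMap F K g)
    {m : ℕ} (hm : ¬ n ∣ m) : Algebra.trace F K (μ ^ m) = 0 := by
  have hn : 0 < n := by
    rcases Nat.eq_zero_or_pos n with rfl | h
    · exact absurd (Module.finrank_eq_card_basis b) (by
        have := Module.Finite.of_basis b
        simpa using (Module.finrank_pos (R := F) (M := K)).ne')
    · exact h
  have hr0 : 0 < m % n := Nat.pos_of_ne_zero fun h => hm (Nat.dvd_of_mod_eq_zero h)
  have hrn : m % n < n := Nat.mod_lt _ hn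
  have h1 : μ ^ m = g ^ (m / n) • μ ^ (m % n) := by
    rw [Algebra.smul_def, map_pow, ← hμ, ← pow_mul, ← pow_add, Nat.div_add_mod]
  rw [h1, map_smul, Algebra.trace_eq_matrix_trace b, Matrix.trace]
  refine smul_eq_zero_of_right _ (Finset.sum_eq_zero fun i _ => ?_)
  rw [Matrix.diag_apply, Algebra.leftMulMatrix_eq_repr_mul, hb, ← pow_add]
  by_cases hi : m % n + i < n
  · rw [← Fin.val_mk hi, ← hb, b.repr_self, Finsupp.single_eq_of_ne]
    intro h
    have := congrArg Fin.val h
    simp at this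
    omega
  · have hlt : m % n + i - n < n := by omega
    have h2 : μ ^ (m % n + (i : ℕ)) = g • μ ^ (m % n + i - n) := by
      rw [Algebra.smul_def, ← hμ, ← pow_add]
      congr 1
      omega
    rw [h2, ← Fin.val_mk hlt, ← hb, map_smul, b.repr_self, Finsupp.smul_apply,
      Finsupp.single_eq_of_ne, smul_zero]
    intro h
    have := congrArg Fin.val h
    simp at this
    omega

/-- The trace of `x * μ ^ (n - j)` kills every coordinate except the `j`-th, which appears with `μ ^
n = g` and the degree `n`. -/
theorem isIntegral_coord_of_isIntegral {R F K : Type*} [CommRing R] [Field F] [Field K]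
    [Algebra R F] [Algebra F K] [Algebra R K] [IsScalarTower R F K] {n : ℕ} {μ : K} {g : R}
    (b : Module.Basis (Fin n) F K) (hb : ∀ j, b j = μ ^ (j : ℕ)) (hμ : μ ^ n = algebraMap R K g)
    {x : K} (hx : IsIntegral R x) (j : Fin n) :
    IsIntegral R ((n : F) * algebraMap R F g * b.repr x j) := by
  have := Module.Finite.of_basis b
  have hn : 0 < n := j.pos
  have hμ' : μ ^ n = algebraMap F K (algebraMap R F g) := by
    rw [hμ, IsScalarTower.algebraMap_apply R F K]
  have hμi : IsIntegral R μ := IsIntegral.of_pow hn (hμ ▸ isIntegral_algebraMap)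
  have htr := Algebra.isIntegral_trace (L := F) (hx.mul (hμi.pow (n - j)))
  convert htr using 1
  conv_rhs => rw [← b.sum_repr x]
  rw [Finset.sum_mul, map_sum, Finset.sum_eq_single j]
  · rw [smul_mul_assoc, hb, ← pow_add, Nat.add_sub_cancel' j.2.le, hμ', map_smul,
      Algebra.trace_algebraMap, Module.finrank_eq_card_basis b, Fintype.card_fin, nsmul_eq_mul,
      smul_eq_mul]
    ring
  · intro l _ hl
    rw [smul_mul_assoc, hb, ← pow_add, map_smul, trace_pow_eq_zero b hb hμ', smul_zero]
    rintro ⟨k, hk⟩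
    have hl' : (l : ℕ) ≠ j := fun h => hl (Fin.ext h)
    have := l.2
    have := j.2
    have hk1 : k < 2 := by
      by_contra hk2
      have := Nat.mul_le_mul_left n (not_lt.1 hk2)
      omega
    interval_cases k <;> omega
  · simp

/-- The power basis of a simple radical extension. -/
theorem exists_basis_adjoin_of_irreducible {L K : Type*} [Field L] [Field K] [Algebra L K] {n : ℕ}
    {ω : K} {a : L} (hn : n ≠ 0) (hω : ω ^ n = algebraMap L K a) (h : Irreducible (X ^ n - C a)) :
    ∃ b : Module.Basis (Fin n) L (IntermediateField.adjoin L {ω}),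
      ∀ i, (b i : K) = ω ^ (i : ℕ) := by
  have hmin : X ^ n - C a = minpoly L ω :=
    minpoly.eq_of_irreducible_of_monic h (by simp [hω]) (monic_X_pow_sub_C a hn)
  have hint : IsIntegral L ω := IsIntegral.of_pow hn.bot_lt (hω ▸ isIntegral_algebraMap)
  let pb := IntermediateField.adjoin.powerBasis hint
  have hdim : pb.dim = n := by
    change (minpoly L ω).natDegree = n
    rw [← hmin, natDegree_X_pow_sub_C]
  refine ⟨pb.basis.reindex (finCongr hdim), fun i => ?_⟩
  rw [Module.Basis.reindex_apply, pb.basis_eq_pow]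
  rfl

theorem exists_basis_of_irreducible {F K : Type*} [Field F] [Field K] [Algebra F K] {n : ℕ}
    {μ : K} {a : F} (hn : n ≠ 0) (hμ : μ ^ n = algebraMap F K a) (h : Irreducible (X ^ n - C a))
    (htop : IntermediateField.adjoin F {μ} = ⊤) :
    ∃ b : Module.Basis (Fin n) F K, ∀ j, b j = μ ^ (j : ℕ) := by
  obtain ⟨b, hb⟩ := exists_basis_adjoin_of_irreducible hn hμ h
  refine ⟨b.map ((IntermediateField.equivOfEq htop).trans
    IntermediateField.topEquiv).toLinearEquiv, fun j => ?_⟩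
  rw [Module.Basis.map_apply, ← hb]
  rfl

theorem adjoin_adjoin_simple_eq_top {L K : Type*} [Field L] [Field K] [Algebra L K] {ω μ : K}
    (h : IntermediateField.adjoin L {ω, μ} = ⊤) :
    IntermediateField.adjoin (IntermediateField.adjoin L {ω}) {μ} = ⊤ := by
  rw [← IntermediateField.restrictScalars_eq_top_iff (K := L),
    IntermediateField.adjoin_simple_adjoin_simple, h]

/-- Degrees: `[K : L] = n ^ 2` and `[L(μ) : L] = n` force `[K : L(μ)] = n`, so the minimal
polynomial of `ω` over `L(μ)` has degree `n`. -/
theorem irreducible_X_pow_sub_C_swap {L K : Type*} [Field L] [Field K] [Algebra L K] {n : ℕ}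
    (hn : n ≠ 0) {ω μ : K} {a b : L} (hω : ω ^ n = algebraMap L K a) (hμ : μ ^ n = algebraMap L K b)
    (hK : IntermediateField.adjoin L {ω, μ} = ⊤)
    (ha : Irreducible (X ^ n - C a)) (hb : Irreducible (X ^ n - C b))
    (hab : Irreducible (X ^ n - C (algebraMap L (IntermediateField.adjoin L {ω}) b))) :
    Irreducible (X ^ n - C (algebraMap L (IntermediateField.adjoin L {μ}) a)) := by
  obtain ⟨bω, -⟩ := exists_basis_adjoin_of_irreducible hn hω ha
  obtain ⟨bμ, -⟩ := exists_basis_adjoin_of_irreducible hn hμ hb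
  obtain ⟨bK, -⟩ := exists_basis_of_irreducible (F := IntermediateField.adjoin L {ω}) hn
    (hμ.trans (IsScalarTower.algebraMap_apply _ _ _ _)) hab (adjoin_adjoin_simple_eq_top hK)
  have h1 := Module.finrank_mul_finrank L (IntermediateField.adjoin L {ω}) K
  have h2 := Module.finrank_mul_finrank L (IntermediateField.adjoin L {μ}) K
  rw [Module.finrank_eq_card_basis bω, Module.finrank_eq_card_basis bK, Fintype.card_fin] at h1
  rw [← h1, Module.finrank_eq_card_basis bμ, Fintype.card_fin] at h2
  have h3 := Nat.eq_of_mul_eq_mul_left hn.bot_lt h2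
  have htop := adjoin_adjoin_simple_eq_top (ω := μ) (μ := ω) (Set.pair_comm ω μ ▸ hK)
  have hω' : ω ^ n = algebraMap (IntermediateField.adjoin L {μ}) K (algebraMap L _ a) :=
    hω.trans (IsScalarTower.algebraMap_apply _ _ _ _)
  have hint : IsIntegral (IntermediateField.adjoin L {μ}) ω :=
    IsIntegral.of_pow hn.bot_lt (hω' ▸ isIntegral_algebraMap)
  have h4 := IntermediateField.adjoin.finrank hint
  rw [htop, IntermediateField.finrank_top', h3] at h4
  have h5 : X ^ n - C (algebraMap L (IntermediateField.adjoin L {μ}) a) =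
      minpoly (IntermediateField.adjoin L {μ}) ω := by
    refine eq_of_monic_of_dvd_of_natDegree_le (minpoly.monic hint)
      (monic_X_pow_sub_C _ hn) (minpoly.dvd _ _ (by simp [hω'])) ?_
    rw [natDegree_X_pow_sub_C, ← h4]
  rw [h5]
  exact minpoly.irreducible hint

/-! ### Coordinates with respect to `ω` and `μ` -/

/-- `ω` and `μ` are `p`-th roots of `f` and `g`, the monomials `ω ^ i * μ ^ j` with `i, j < p` are
linearly independent over `S`, and elements integral over `S` are combinations of them with
denominator `p ^ 2 * f * g`. -/
structure IsKummerPair {S K : Type*} [CommRing S] [Field K] [Algebra S K] (p : ℕ) (f g : S)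
    (ω μ : K) : Prop where
  pow_left : ω ^ p = algebraMap S K f
  pow_right : μ ^ p = algebraMap S K g
  indep : ∀ c : Fin p → Fin p → S,
    ∑ j, (∑ i, algebraMap S K (c i j) * ω ^ (i : ℕ)) * μ ^ (j : ℕ) = 0 → ∀ i j, c i j = 0
  coeff_left : ∀ x : K, IsIntegral S x → ∃ c : Fin p → Fin p → S,
    ∑ j, (∑ i, algebraMap S K (c i j) * ω ^ (i : ℕ)) * μ ^ (j : ℕ) =
      algebraMap S K (p ^ 2 * f * g) * x ∧
    ∀ j, ∃ y, IsIntegral S y ∧ ∑ i, algebraMap S K (c i j) * ω ^ (i : ℕ) = algebraMap S K f * y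
  coeff_right : ∀ x : K, IsIntegral S x → ∃ c : Fin p → Fin p → S,
    ∑ j, (∑ i, algebraMap S K (c i j) * μ ^ (i : ℕ)) * ω ^ (j : ℕ) =
      algebraMap S K (p ^ 2 * g * f) * x ∧
    ∀ j, ∃ y, IsIntegral S y ∧ ∑ i, algebraMap S K (c i j) * μ ^ (i : ℕ) = algebraMap S K g * y

theorem IsKummerPair.swap {S K : Type*} [CommRing S] [Field K] [Algebra S K] {p : ℕ} {f g : S}
    {ω μ : K} (h : IsKummerPair p f g ω μ) : IsKummerPair p g f μ ω where
  pow_left := h.pow_right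
  pow_right := h.pow_left
  indep c hc i j := by
    refine h.indep (fun i j => c j i) ?_ j i
    rw [← hc]
    simp only [Finset.sum_mul]
    rw [Finset.sum_comm]
    exact Finset.sum_congr rfl fun _ _ => Finset.sum_congr rfl fun _ _ => by ring
  coeff_left := h.coeff_right
  coeff_right := h.coeff_left

section

variable {S L F K : Type*} [CommRing S] [Field L] [Field F]
  [Field K] [Algebra S L] [IsFractionRing S L] [Algebra L F] [Algebra F K] [Algebra S F]
  [Algebra S K] [IsScalarTower S L F] [IsScalarTower S F K]

/-- The coordinate bound is used twice: over `F` it costs `n * g`, over `L` a further `n * f`. That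
each inner sum is `f` times an integral element is what the Eisenstein argument at `f` consumes. -/
theorem exists_coeff_of_basis [IsIntegrallyClosed S] {n : ℕ} {ω : F} {μ : K} {f g : S}
    (hω : ω ^ n = algebraMap S F f) (hμ : μ ^ n = algebraMap S K g)
    (bF : Module.Basis (Fin n) L F) (hF : ∀ i, bF i = ω ^ (i : ℕ))
    (bK : Module.Basis (Fin n) F K) (hbK : ∀ j, bK j = μ ^ (j : ℕ)) {x : K} (hx : IsIntegral S x) :
    ∃ c : Fin n → Fin n → S,
      ∑ j, (∑ i, algebraMap S K (c i j) * algebraMap F K ω ^ (i : ℕ)) * μ ^ (j : ℕ) =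
        algebraMap S K (n ^ 2 * f * g) * x ∧
      ∀ j, ∃ y, IsIntegral S y ∧
        ∑ i, algebraMap S K (c i j) * algebraMap F K ω ^ (i : ℕ) = algebraMap S K f * y := by
  have h1 := isIntegral_coord_of_isIntegral bK hbK hμ hx
  have h2 : ∀ j i, ∃ c, algebraMap S L c = (n : L) * algebraMap S L f *
      bF.repr (n * algebraMap S F g * bK.repr x j) i := fun j i =>
    IsIntegrallyClosed.isIntegral_iff.1 (isIntegral_coord_of_isIntegral bF hF hω (h1 j) i)
  choose c hc using h2
  have hsum : ∀ j, ∑ i, algebraMap S K (c j i) * algebraMap F K ω ^ (i : ℕ) =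
      algebraMap S K f * (n * algebraMap F K (n * algebraMap S F g * bK.repr x j)) := by
    intro j
    have h3 : ∑ i, algebraMap S F (c j i) * ω ^ (i : ℕ) =
        algebraMap S F f * (n * (n * algebraMap S F g * bK.repr x j)) := by
      conv_rhs => rw [← bF.sum_repr (n * algebraMap S F g * bK.repr x j), Finset.mul_sum,
        Finset.mul_sum]
      refine Finset.sum_congr rfl fun i _ => ?_
      rw [IsScalarTower.algebraMap_apply S L F, hc, hF, Algebra.smul_def, map_mul, map_mul,
        map_natCast, ← IsScalarTower.algebraMap_apply S L F]
      ring
    have h4 := congrArg (algebraMap F K) h3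
    simpa only [map_sum, map_mul, map_pow, map_natCast, ← IsScalarTower.algebraMap_apply S F K]
      using h4
  refine ⟨fun i j => c j i, ?_, fun j => ⟨_, ?_, hsum j⟩⟩
  · conv_rhs => rw [← bK.sum_repr x, Finset.mul_sum]
    refine Finset.sum_congr rfl fun j _ => ?_
    rw [hsum, hbK, Algebra.smul_def]
    simp only [map_mul, map_natCast, map_pow, ← IsScalarTower.algebraMap_apply S F K]
    ring
  · have := ((h1 j).algebraMap (B := K))
    refine IsIntegral.mul ?_ this
    simpa using isIntegral_algebraMap (R := S) (A := K) (x := n)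

theorem indep_of_basis {n : ℕ} {ω : F} {μ : K} (bF : Module.Basis (Fin n) L F)
    (hF : ∀ i, bF i = ω ^ (i : ℕ)) (bK : Module.Basis (Fin n) F K)
    (hbK : ∀ j, bK j = μ ^ (j : ℕ)) (c : Fin n → Fin n → S)
    (hc : ∑ j, (∑ i, algebraMap S K (c i j) * algebraMap F K ω ^ (i : ℕ)) * μ ^ (j : ℕ) = 0)
    (i j : Fin n) : c i j = 0 := by
  have h1 := Fintype.linearIndependent_iff.1 bK.linearIndependent
    (fun j => ∑ i, algebraMap S F (c i j) * ω ^ (i : ℕ)) (by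
      rw [← hc]
      refine Finset.sum_congr rfl fun j _ => ?_
      simp only [Algebra.smul_def, hbK, map_sum, map_mul, map_pow,
        ← IsScalarTower.algebraMap_apply S F K]) j
  have h2 := Fintype.linearIndependent_iff.1 bF.linearIndependent
    (fun i => algebraMap S L (c i j)) (by
      rw [← h1]
      refine Finset.sum_congr rfl fun i _ => ?_
      rw [Algebra.smul_def, hF, ← IsScalarTower.algebraMap_apply S L F]) i
  exact IsFractionRing.injective S L (h2.trans (map_zero _).symm)

end

theorem isKummerPair_of_irreducible {S L K : Type*} [CommRing S] [IsDomain S] [IsIntegrallyClosed S]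
    [Field L] [Algebra S L] [IsFractionRing S L] [Field K] [Algebra L K] [Algebra S K]
    [IsScalarTower S L K] {p : ℕ} (hp : p.Prime) {f g : S}
    (hf : ¬ ∃ x : S, f = x ^ p) (hg : ¬ ∃ x : S, g = x ^ p) {ω μ : K}
    (hω : ω ^ p = algebraMap S K f) (hμ : μ ^ p = algebraMap S K g)
    (hirr : Irreducible (X ^ p -
      C (algebraMap L (IntermediateField.adjoin L {ω}) (algebraMap S L g))))
    (hK : IntermediateField.adjoin L {ω, μ} = ⊤) : IsKummerPair p f g ω μ := by
  -- A `p`-th root of `f` in `L` would be integral over `S`, hence in `S`.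
  have key : ∀ f : S, (¬ ∃ x : S, f = x ^ p) → Irreducible (X ^ p - C (algebraMap S L f)) := by
    intro f hf
    refine X_pow_sub_C_irreducible_of_prime hp fun b hb => hf ?_
    obtain ⟨x, rfl⟩ := IsIntegrallyClosed.isIntegral_iff.1
      (IsIntegral.of_pow hp.pos (hb ▸ isIntegral_algebraMap) : IsIntegral S b)
    exact ⟨x, IsFractionRing.injective S L (by rw [← hb, map_pow])⟩
  have hω' : ω ^ p = algebraMap L K (algebraMap S L f) := by
    rw [hω, IsScalarTower.algebraMap_apply S L K]
  have hμ' : μ ^ p = algebraMap L K (algebraMap S L g) := by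
    rw [hμ, IsScalarTower.algebraMap_apply S L K]
  have hirr' := irreducible_X_pow_sub_C_swap hp.ne_zero hω' hμ' hK (key f hf) (key g hg) hirr
  have aux : ∀ {f g : S} {ω μ : K}, ω ^ p = algebraMap S K f → μ ^ p = algebraMap S K g →
      ω ^ p = algebraMap L K (algebraMap S L f) → μ ^ p = algebraMap L K (algebraMap S L g) →
      Irreducible (X ^ p - C (algebraMap S L f)) →
      Irreducible (X ^ p -
        C (algebraMap L (IntermediateField.adjoin L {ω}) (algebraMap S L g))) →
      IntermediateField.adjoin L {ω, μ} = ⊤ →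
      (∀ c : Fin p → Fin p → S,
        ∑ j, (∑ i, algebraMap S K (c i j) * ω ^ (i : ℕ)) * μ ^ (j : ℕ) = 0 → ∀ i j, c i j = 0) ∧
      ∀ x : K, IsIntegral S x → ∃ c : Fin p → Fin p → S,
        ∑ j, (∑ i, algebraMap S K (c i j) * ω ^ (i : ℕ)) * μ ^ (j : ℕ) =
          algebraMap S K (p ^ 2 * f * g) * x ∧
        ∀ j, ∃ y, IsIntegral S y ∧
          ∑ i, algebraMap S K (c i j) * ω ^ (i : ℕ) = algebraMap S K f * y := by
    intro f g ω μ h1 h2 h1' h2' h3 h4 h5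
    obtain ⟨bF, hF⟩ := exists_basis_adjoin_of_irreducible hp.ne_zero h1' h3
    obtain ⟨bK, hbK⟩ := exists_basis_of_irreducible (F := IntermediateField.adjoin L {ω})
      hp.ne_zero (h2'.trans (IsScalarTower.algebraMap_apply _ _ _ _)) h4
      (adjoin_adjoin_simple_eq_top h5)
    have htower : IsScalarTower S (IntermediateField.adjoin L {ω}) K :=
      IsScalarTower.of_algebraMap_eq fun x => by
        rw [IsScalarTower.algebraMap_apply S L (IntermediateField.adjoin L {ω}),
          ← IsScalarTower.algebraMap_apply L _ K, IsScalarTower.algebraMap_apply S L K]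
    have hF' : ∀ i, bF i = IntermediateField.AdjoinSimple.gen L ω ^ (i : ℕ) :=
      fun i => Subtype.ext (by rw [hF]; simp)
    have hgen : IntermediateField.AdjoinSimple.gen L ω ^ p = algebraMap S _ f :=
      (algebraMap _ K).injective (by
        rw [← IsScalarTower.algebraMap_apply S _ K, map_pow]
        simpa using h1)
    exact ⟨fun c hc => indep_of_basis bF hF' bK hbK c (by simpa using hc),
      fun x hx => by simpa using exists_coeff_of_basis hgen h2 bF hF' bK hbK hx⟩
  obtain ⟨h1, h2⟩ := aux hω hμ hω' hμ' (key f hf) hirr hK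
  exact ⟨hω, hμ, h1, h2,
    (aux hμ hω hμ' hω' (key g hg) hirr' (by rw [Set.pair_comm]; exact hK)).2⟩

/-! ### Adjoined roots and Frobenius modulo `p` -/

theorem mem_adjoin_singleton_iff_exists_sum {R A : Type*} [CommRing R] [Nontrivial R]
    [CommRing A] [Algebra R A] {n : ℕ} (hn : n ≠ 0) {μ : A} {g : R}
    (hμ : μ ^ n = algebraMap R A g) {x : A} :
    x ∈ Algebra.adjoin R {μ} ↔ ∃ t : Fin n → R, x = ∑ j, algebraMap R A (t j) * μ ^ (j : ℕ) := by
  constructor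
  · intro hx
    rw [Algebra.adjoin_singleton_eq_range_aeval] at hx
    obtain ⟨P, rfl⟩ := hx
    have hmon : (X ^ n - C g).Monic := monic_X_pow_sub_C g hn
    have h0 : aeval μ (X ^ n - C g) = 0 := by simp [hμ]
    refine ⟨fun j => (P %ₘ (X ^ n - C g)).coeff j, ?_⟩
    change aeval μ P = _
    conv_lhs => rw [← modByMonic_add_div P (X ^ n - C g)]
    rw [map_add, map_mul, h0, zero_mul, add_zero,
      aeval_eq_sum_range' (n := n) (by
        have := natDegree_modByMonic_lt P hmon (fun h => hn (by
          rw [← natDegree_X_pow_sub_C (n := n) (r := g), h, natDegree_one]))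
        rwa [natDegree_X_pow_sub_C] at this), Finset.sum_range]
    exact Finset.sum_congr rfl fun j _ => Algebra.smul_def _ _
  · rintro ⟨t, rfl⟩
    exact sum_mem fun j _ => mul_mem (Subalgebra.algebraMap_mem _ _)
      (pow_mem (Algebra.self_mem_adjoin_singleton R μ) _)

theorem mem_adjoin_pair_iff {S A : Type*} [CommRing S] [CommRing A] [Algebra S A] {ω μ x : A} :
    x ∈ Algebra.adjoin S {ω, μ} ↔
      x ∈ Algebra.adjoin (Algebra.adjoin S {ω}) {μ} := by
  rw [Set.insert_eq, Algebra.adjoin_union_eq_adjoin_adjoin]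
  rfl

/-- Frobenius is a ring homomorphism modulo `p`, so the claim passes from the generators to the
whole algebra. -/
theorem exists_pow_prime_eq_add_of_adjoin {S A : Type*} [CommRing S] [CommRing A] [Algebra S A]
    {p : ℕ} (hp : p.Prime) {s : Set A} (hs : ∀ x ∈ s, ∃ a, x ^ p = algebraMap S A a)
    (x : Algebra.adjoin S s) :
    ∃ (a : S) (b : Algebra.adjoin S s), x ^ p = algebraMap S _ a + p * b := by
  obtain ⟨x, hx⟩ := x
  induction hx using Algebra.adjoin_induction with
  | mem x hx =>
    obtain ⟨a, ha⟩ := hs x hx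
    exact ⟨a, 0, Subtype.ext (by simpa using ha)⟩
  | algebraMap r => exact ⟨r ^ p, 0, Subtype.ext (by simp)⟩
  | add x y hx hy ihx ihy =>
    obtain ⟨a, b, h⟩ := ihx
    obtain ⟨a', b', h'⟩ := ihy
    obtain ⟨r, hr⟩ := exists_add_pow_prime_eq hp (⟨x, hx⟩ : Algebra.adjoin S s) ⟨y, hy⟩
    refine ⟨a + a', b + b' + ⟨x, hx⟩ * ⟨y, hy⟩ * r, ?_⟩
    change (⟨x, hx⟩ + ⟨y, hy⟩ : Algebra.adjoin S s) ^ p = _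
    rw [hr, h, h', map_add]
    ring
  | mul x y hx hy ihx ihy =>
    obtain ⟨a, b, h⟩ := ihx
    obtain ⟨a', b', h'⟩ := ihy
    refine ⟨a * a', algebraMap S _ a * b' + b * algebraMap S _ a' + p * b * b', ?_⟩
    change (⟨x, hx⟩ * ⟨y, hy⟩ : Algebra.adjoin S s) ^ p = _
    rw [mul_pow, h, h', map_mul]
    ring

/-! ### The unique height one prime over `p` -/

section Radical

variable {S A : Type*} [CommRing S] [CommRing A] [Algebra S A] {p : ℕ}

theorem mem_radical_pIdeal_iff (hp : p ≠ 0) {a : A} {s : S} {b : A}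
    (h : a ^ p = algebraMap S A s + p * b) (hpS : Prime (p : S))
    (hS : ∀ s : S, (p : A) ∣ algebraMap S A s → (p : S) ∣ s) :
    a ∈ (pIdeal p A).radical ↔ (p : S) ∣ s := by
  constructor
  · rintro ⟨n, hn⟩
    rw [Ideal.mem_span_singleton] at hn
    refine hpS.dvd_of_dvd_pow (n := n) (hS _ ?_)
    have h1 : (p : A) ∣ (a ^ p) ^ n := by
      rw [← pow_mul, mul_comm, pow_mul]
      exact dvd_pow hn hp
    have h2 : (p : A) ∣ (a ^ p) ^ n - algebraMap S A s ^ n := by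
      refine dvd_trans ?_ (sub_dvd_pow_sub_pow (a ^ p) (algebraMap S A s) n)
      rw [h, add_sub_cancel_left]
      exact dvd_mul_right _ _
    rw [map_pow]
    exact (dvd_sub_right h1).1 h2
  · rintro ⟨c, rfl⟩
    refine ⟨p, Ideal.mem_span_singleton.2 ?_⟩
    rw [h, map_mul, map_natCast]
    exact dvd_add (dvd_mul_right _ _) (dvd_mul_right _ _)

/-- The assignment `a ↦ s` is multiplicative modulo `p` and detects membership in the radical, so
primality of `p` in `S` transfers. -/
theorem isPrime_radical_pIdeal (hp : p ≠ 0) (hpS : Prime (p : S))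
    (hA : ∀ a : A, ∃ (s : S) (b : A), a ^ p = algebraMap S A s + p * b)
    (hS : ∀ s : S, (p : A) ∣ algebraMap S A s → (p : S) ∣ s) :
    (pIdeal p A).radical.IsPrime := by
  refine ⟨fun h => hpS.not_isUnit (isUnit_of_dvd_one (hS 1 ?_)), fun {x y} hxy => ?_⟩
  · rw [Ideal.radical_eq_top, Ideal.eq_top_iff_one, Ideal.mem_span_singleton] at h
    rwa [map_one]
  · obtain ⟨s, b, h⟩ := hA x
    obtain ⟨s', b', h'⟩ := hA y
    have hm : (x * y) ^ p = algebraMap S A (s * s') +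
        p * (algebraMap S A s * b' + b * algebraMap S A s' + p * b * b') := by
      rw [mul_pow, h, h', map_mul]
      ring
    rw [mem_radical_pIdeal_iff hp hm hpS hS] at hxy
    rw [mem_radical_pIdeal_iff hp h hpS hS, mem_radical_pIdeal_iff hp h' hpS hS]
    exact hpS.dvd_or_dvd hxy

/-- Every prime containing `p` contains the radical, which has height one by Krull; a strictly
larger prime has larger height. -/
theorem existsUnique_height_one_of_mem [IsDomain A] [IsNoetherianRing A] (hpA : (p : A) ≠ 0)
    (hprime : (pIdeal p A).radical.IsPrime) :
    ∃! P : Ideal A, P.IsPrime ∧ P.height = 1 ∧ (p : A) ∈ P := by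
  have hmem : (p : A) ∈ (pIdeal p A).radical :=
    Ideal.le_radical (Ideal.mem_span_singleton_self _)
  have hle : ∀ Q : Ideal A, Q.IsPrime → (p : A) ∈ Q → (pIdeal p A).radical ≤ Q := fun Q hQ hpQ =>
    hQ.radical_le_iff.2 ((Ideal.span_singleton_le_iff_mem _).2 hpQ)
  have hh : (pIdeal p A).radical.height = 1 := by
    refine le_antisymm (Ideal.height_le_one_of_isPrincipal_of_mem_minimalPrimes (pIdeal p A) _
      ⟨⟨hprime, Ideal.le_radical⟩, fun Q hQ _ => hQ.1.radical_le_iff.2 hQ.2⟩) ?_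
    rw [Order.one_le_iff_ne_zero, Ne, Ideal.height_eq_zero_iff_eq_bot]
    exact fun h => hpA ((Submodule.mem_bot A).1 (h ▸ hmem))
  refine ⟨_, ⟨hprime, hh, hmem⟩, fun Q ⟨hQ, hQ1, hpQ⟩ => ?_⟩
  by_contra hne
  have := Ideal.height_strict_mono_of_isPrime (lt_of_le_of_ne (hle Q hQ hpQ) (Ne.symm hne))
  rw [hh, hQ1] at this
  exact lt_irrefl _ this

end Radical

/-! ### Divisibility from normality and square-freeness -/

theorem dvd_of_algebraMap_eq_mul {S K : Type*} [CommRing S] [IsDomain S] [IsIntegrallyClosed S]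
    [Field K] [Algebra S K] [FaithfulSMul S K] {r s : S} (hs : s ≠ 0) {x : K}
    (hx : IsIntegral S x) (h : algebraMap S K r = algebraMap S K s * x) : s ∣ r := by
  let _ := FractionRing.liftAlgebra S K
  have hinj := FaithfulSMul.algebraMap_injective S K
  have hs' : algebraMap S K s ≠ 0 := fun h0 => hs (hinj (h0.trans (map_zero _).symm))
  have h1 : x = algebraMap (FractionRing S) K
      (algebraMap S _ r / algebraMap S (FractionRing S) s) := by
    rw [map_div₀, ← IsScalarTower.algebraMap_apply, ← IsScalarTower.algebraMap_apply, h,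
      mul_div_cancel_left₀ _ hs']
  rw [h1, isIntegral_algebraMap_iff (algebraMap (FractionRing S) K).injective] at hx
  obtain ⟨y, hy⟩ := IsIntegrallyClosed.isIntegral_iff.1 hx
  refine ⟨y, hinj ?_⟩
  rw [h, h1, ← hy, ← IsScalarTower.algebraMap_apply, map_mul]

/-- Normality of `S / pS` enters here: a `p`-th power in its fraction field is already one in `S /
pS`. -/
theorem dvd_of_not_mem_frobLift {S : Type*} [CommRing S] {p : ℕ} (hp : p.Prime)
    (hpS : Prime (p : S)) [IsIntegrallyClosed (S ⧸ pIdeal p S)] {f : S} (hf : f ∉ frobLift p S)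
    (a b : S) (h : (p : S) ∣ a ^ p - f * b ^ p) : (p : S) ∣ b := by
  have hprime : (pIdeal p S).IsPrime := (Ideal.span_singleton_prime hpS.ne_zero).2 hpS
  by_contra hb
  have hb0 : Ideal.Quotient.mk (pIdeal p S) b ≠ 0 := fun h0 =>
    hb (Ideal.mem_span_singleton.1 (Ideal.Quotient.eq_zero_iff_mem.1 h0))
  have h1 := Ideal.Quotient.eq.2 (Ideal.mem_span_singleton.2 h : _ ∈ pIdeal p S)
  rw [map_mul, map_pow, map_pow] at h1
  obtain ⟨c, hc⟩ := (IsIntegrallyClosed.pow_dvd_pow_iff hp.ne_zero).1 (Dvd.intro_left _ h1.symm)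
  refine hf ⟨c, mul_left_cancel₀ (pow_ne_zero p hb0) ?_⟩
  rw [← mul_pow, ← hc, h1, mul_comm]

theorem IsSqFreeElem.exists_dvd_mul {S : Type*} [CommRing S] [IsDomain S] {f : S}
    (hf : IsSqFreeElem f) {q : Ideal S} [q.IsPrime] (hq : q.height = 1) (hfq : f ∈ q) {r : S} (hr : r ∈ q) :
    ∃ t ∉ q, f ∣ t * r := by
  have h1 := Ideal.mem_map_of_mem (algebraMap S (Localization.AtPrime q)) hr
  rw [hf q hq hfq, Ideal.mem_span_singleton] at h1
  obtain ⟨z, hz⟩ := h1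
  obtain ⟨⟨a, t⟩, hat⟩ := IsLocalization.surj q.primeCompl z
  refine ⟨t, t.2, a, ?_⟩
  have hinj := IsLocalization.injective (Localization.AtPrime q) q.primeCompl_le_nonZeroDivisors
  refine hinj ?_
  rw [map_mul, map_mul, hz, ← hat]
  ring

/-! ### Reduction of normality to saturation at `p` -/

namespace IsKummerPair

variable {S K : Type*} [CommRing S] [Field K] [Algebra S K] {p : ℕ} {f g : S} {ω μ : K}

theorem isIntegral_left (h : IsKummerPair p f g ω μ) (hp : p.Prime) : IsIntegral S ω :=
  IsIntegral.of_pow hp.pos (h.pow_left ▸ isIntegral_algebraMap)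

theorem adjoin_left_le (h : IsKummerPair p f g ω μ) (hp : p.Prime) :
    Algebra.adjoin S {ω} ≤ integralClosure S K :=
  Algebra.adjoin_le (Set.singleton_subset_iff.2 (h.isIntegral_left hp))

theorem adjoin_le (h : IsKummerPair p f g ω μ) (hp : p.Prime) :
    Algebra.adjoin S {ω, μ} ≤ integralClosure S K := by
  refine Algebra.adjoin_le ?_
  rintro x (rfl | rfl)
  · exact h.isIntegral_left hp
  · exact h.swap.isIntegral_left hp

theorem exists_pow_eq_left (h : IsKummerPair p f g ω μ) (hp : p.Prime) (a : Algebra.adjoin S {ω}) :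
    ∃ (s : S) (b : Algebra.adjoin S {ω}), a ^ p = algebraMap S _ s + p * b :=
  exists_pow_prime_eq_add_of_adjoin hp (by rintro x rfl; exact ⟨f, h.pow_left⟩) a

theorem exists_pow_eq (h : IsKummerPair p f g ω μ) (hp : p.Prime) (a : Algebra.adjoin S {ω, μ}) :
    ∃ (s : S) (b : Algebra.adjoin S {ω, μ}), a ^ p = algebraMap S _ s + p * b :=
  exists_pow_prime_eq_add_of_adjoin hp (by
    rintro x (rfl | rfl)
    exacts [⟨f, h.pow_left⟩, ⟨g, h.pow_right⟩]) a

theorem mem_adjoin_left_iff [IsDomain S] (h : IsKummerPair p f g ω μ) (hp : p.Prime) {x : K} :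
    x ∈ Algebra.adjoin S {ω} ↔
      ∃ c : Fin p → S, x = ∑ i, algebraMap S K (c i) * ω ^ (i : ℕ) :=
  mem_adjoin_singleton_iff_exists_sum hp.ne_zero h.pow_left

theorem mem_adjoin_iff_exists_left [IsDomain S] (h : IsKummerPair p f g ω μ) (hp : p.Prime)
    {x : K} : x ∈ Algebra.adjoin S {ω, μ} ↔
      ∃ t : Fin p → Algebra.adjoin S {ω}, x = ∑ j, (t j : K) * μ ^ (j : ℕ) := by
  rw [mem_adjoin_pair_iff]
  exact mem_adjoin_singleton_iff_exists_sum (R := Algebra.adjoin S {ω}) hp.ne_zero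
    (g := algebraMap S _ g) h.pow_right

theorem mem_adjoin_iff [IsDomain S] (h : IsKummerPair p f g ω μ) (hp : p.Prime) {x : K} :
    x ∈ Algebra.adjoin S {ω, μ} ↔ ∃ c : Fin p → Fin p → S,
      x = ∑ j, (∑ i, algebraMap S K (c i j) * ω ^ (i : ℕ)) * μ ^ (j : ℕ) := by
  rw [h.mem_adjoin_iff_exists_left hp]
  constructor
  · rintro ⟨t, rfl⟩
    choose c hc using fun j => (h.mem_adjoin_left_iff hp).1 (t j).2
    exact ⟨fun i j => c j i, Finset.sum_congr rfl fun j _ => by rw [hc]⟩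
  · rintro ⟨c, rfl⟩
    exact ⟨fun j => ⟨_, (h.mem_adjoin_left_iff hp).2 ⟨fun i => c i j, rfl⟩⟩, rfl⟩

theorem coeff_ext (h : IsKummerPair p f g ω μ) {c d : Fin p → Fin p → S}
    (hcd : ∑ j, (∑ i, algebraMap S K (c i j) * ω ^ (i : ℕ)) * μ ^ (j : ℕ) =
      ∑ j, (∑ i, algebraMap S K (d i j) * ω ^ (i : ℕ)) * μ ^ (j : ℕ)) (i j : Fin p) :
    c i j = d i j := by
  rw [← sub_eq_zero]
  refine h.indep (fun i j => c i j - d i j) ?_ i j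
  simp only [map_sub, sub_mul, Finset.sum_sub_distrib]
  exact sub_eq_zero.2 hcd

theorem mul_sum (a : S) (c : Fin p → Fin p → S) :
    algebraMap S K a * ∑ j, (∑ i, algebraMap S K (c i j) * ω ^ (i : ℕ)) * μ ^ (j : ℕ) =
      ∑ j, (∑ i, algebraMap S K (a * c i j) * ω ^ (i : ℕ)) * μ ^ (j : ℕ) := by
  simp only [Finset.mul_sum, Finset.sum_mul, map_mul, mul_assoc]

theorem coeff_left_ext (h : IsKummerPair p f g ω μ) (hp : p.Prime)
    {t u : Fin p → Algebra.adjoin S {ω}} [IsDomain S]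
    (htu : ∑ j, (t j : K) * μ ^ (j : ℕ) = ∑ j, (u j : K) * μ ^ (j : ℕ)) : t = u := by
  choose c hc using fun j => (h.mem_adjoin_left_iff hp).1 (t j).2
  choose d hd using fun j => (h.mem_adjoin_left_iff hp).1 (u j).2
  simp only [hc, hd] at htu
  have := h.coeff_ext (c := fun i j => c j i) (d := fun i j => d j i) htu
  ext j
  rw [hc, hd]
  exact Finset.sum_congr rfl fun i _ => by rw [this i j]

/-- Coordinates `c` of `a * x` and `d` of `t * x` satisfy `t * c = a * d`, so the prime `a` divides
each `c i j`. -/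
theorem mem_adjoin_of_mul_mem [IsDomain S] (h : IsKummerPair p f g ω μ) (hp : p.Prime) {a t : S}
    (ha : Prime a) (hat : ¬ a ∣ t) {x : K} (hx : algebraMap S K a * x ∈ Algebra.adjoin S {ω, μ})
    (htx : algebraMap S K t * x ∈ Algebra.adjoin S {ω, μ}) (ha0 : algebraMap S K a ≠ 0) :
    x ∈ Algebra.adjoin S {ω, μ} := by
  obtain ⟨c, hc⟩ := (h.mem_adjoin_iff hp).1 hx
  obtain ⟨d, hd⟩ := (h.mem_adjoin_iff hp).1 htx
  have h1 := h.coeff_ext (c := fun i j => t * c i j) (d := fun i j => a * d i j) (by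
    rw [← mul_sum, ← mul_sum, ← hc, ← hd]
    ring)
  choose e he using fun i j => (ha.dvd_or_dvd ⟨_, h1 i j⟩).resolve_left hat
  refine (h.mem_adjoin_iff hp).2 ⟨e, mul_left_cancel₀ ha0 ?_⟩
  rw [mul_sum, hc]
  simp only [he]

theorem exists_mul_mem_of_mem [IsDomain S] [IsIntegrallyClosed S] [FaithfulSMul S K]
    (h : IsKummerPair p f g ω μ) (hp : p.Prime) (q : Ideal S) [q.IsPrime] (hf0 : f ≠ 0)
    (hfq : f ∈ q) (hpq : (p : S) ∉ q) (hgq : g ∉ q) (hq : ∀ r ∈ q, ∃ t ∉ q, f ∣ t * r) {x : K}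
    (hx : IsIntegral S x) : ∃ t ∉ q, algebraMap S K t * x ∈ Algebra.adjoin S {ω, μ} := by
  obtain ⟨c, hc, hy⟩ := h.coeff_left x hx
  have hinj := FaithfulSMul.algebraMap_injective S K
  have hfK : algebraMap S K f ≠ 0 := fun h0 => hf0 (hinj (h0.trans (map_zero _).symm))
  let w : integralClosure S K := ⟨ω, h.isIntegral_left hp⟩
  have hmem : ∀ i j, c i j ∈ q := by
    intro i j
    obtain ⟨y, hyi, hyc⟩ := hy j
    -- `ω ^ p = f` is the Eisenstein equation `z ^ n = π * (d + z * y)` with `d = 1` and `y = 0`.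
    refine mem_of_dvd_sum_of_eisenstein (algebraMap S (integralClosure S K)) q (π := f)
      (fun h0 => hfK (congrArg Subtype.val h0)) hq ?_ (z := w) (y := 0) (d := 1)
      (fun h1 => Ideal.IsPrime.ne_top' ((Ideal.eq_top_iff_one q).2 h1)) ?_ (fun i => c i j) ?_ i
    · rintro r ⟨b, hb⟩
      exact Ideal.mem_of_dvd _ (dvd_of_algebraMap_eq_mul hf0 b.2 (congrArg Subtype.val hb)) hfq
    · exact Subtype.ext (by simpa using h.pow_left)
    · exact ⟨⟨y, hyi⟩, Subtype.ext (by simpa using hyc)⟩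
  choose t ht s hs using fun i j => hq _ (hmem i j)
  have hT : ∏ i, ∏ j, t i j ∉ q := fun hm => by
    obtain ⟨i, -, hi⟩ := Ideal.IsPrime.prod_mem_iff.1 hm
    obtain ⟨j, -, hj⟩ := Ideal.IsPrime.prod_mem_iff.1 hi
    exact ht i j hj
  have hdvd : ∀ i j, f ∣ (∏ i, ∏ j, t i j) * c i j := fun i j =>
    (Dvd.intro _ (hs i j).symm).trans (mul_dvd_mul_right ((Finset.dvd_prod_of_mem
      (fun j => t i j) (Finset.mem_univ j)).trans (Finset.dvd_prod_of_mem
      (fun i => ∏ j, t i j) (Finset.mem_univ i))) _)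
  choose e he using hdvd
  -- The product absorbs the factor `f` of the denominator `p ^ 2 * f * g`; the rest lies outside
  -- `q`.
  refine ⟨(∏ i, ∏ j, t i j) * (p ^ 2 * g), fun hm => ?_, (h.mem_adjoin_iff hp).2 ⟨e, ?_⟩⟩
  · rcases Ideal.IsPrime.mem_or_mem inferInstance hm with hm | hm
    · exact hT hm
    · rcases Ideal.IsPrime.mem_or_mem inferInstance hm with hm | hm
      · exact hpq (Ideal.IsPrime.mem_of_pow_mem inferInstance _ hm)
      · exact hgq hm
  · refine mul_left_cancel₀ hfK ?_
    rw [mul_sum]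
    simp only [← he]
    rw [← mul_sum, hc]
    simp only [map_mul]
    ring

theorem isFractionRing_adjoin [IsDomain S] [FaithfulSMul S K] [Algebra.IsAlgebraic S K]
    (h : IsKummerPair p f g ω μ) (hp : p.Prime) (hδ : (p : S) ^ 2 * f * g ≠ 0) :
    IsFractionRing (Algebra.adjoin S {ω, μ}) K := by
  have hinj := FaithfulSMul.algebraMap_injective S K
  refine IsFractionRing.of_field _ _ fun x => ?_
  obtain ⟨y, hy0, hy⟩ := (Algebra.IsAlgebraic.isAlgebraic (R := S) x).exists_integral_multiple
  obtain ⟨c, hc, -⟩ := h.coeff_left _ hy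
  have h0 : algebraMap S K (p ^ 2 * f * g * y) ≠ 0 := fun h0 =>
    mul_ne_zero hδ hy0 (hinj (h0.trans (map_zero _).symm))
  refine ⟨⟨_, (h.mem_adjoin_iff hp).2 ⟨c, rfl⟩⟩, algebraMap S _ (p ^ 2 * f * g * y), ?_⟩
  rw [← IsScalarTower.algebraMap_apply, eq_div_iff h0]
  change _ = ∑ j, (∑ i, algebraMap S K (c i j) * ω ^ (i : ℕ)) * μ ^ (j : ℕ)
  rw [hc, Algebra.smul_def, map_mul _ _ y]
  ring

/-- The coordinates of `x` are the fractions `c i j / δ`, and each lies in `S` because it does so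
locally in height one. -/
theorem mem_adjoin_of_forall_height_one [IsDomain S] [IsNoetherianRing S] [IsIntegrallyClosed S]
    [FaithfulSMul S K] (h : IsKummerPair p f g ω μ) (hp : p.Prime)
    (hδ : (p : S) ^ 2 * f * g ≠ 0) {x : K} (hx : IsIntegral S x)
    (hloc : ∀ q : Ideal S, q.IsPrime → q.height = 1 →
      ∃ t ∉ q, algebraMap S K t * x ∈ Algebra.adjoin S {ω, μ}) :
    x ∈ Algebra.adjoin S {ω, μ} := by
  obtain ⟨c, hc, -⟩ := h.coeff_left x hx
  generalize (p : S) ^ 2 * f * g = δ at hδ hc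
  have hinj := FaithfulSMul.algebraMap_injective S K
  have hδK : algebraMap S K δ ≠ 0 := fun h0 => hδ (hinj (h0.trans (map_zero _).symm))
  have hδL : algebraMap S (FractionRing S) δ ≠ 0 := fun h0 =>
    hδ (IsFractionRing.injective S (FractionRing S) (h0.trans (map_zero _).symm))
  have hcoord : ∀ i j, ∃ e, algebraMap S (FractionRing S) e =
      algebraMap S (FractionRing S) (c i j) / algebraMap S (FractionRing S) δ := by
    intro i j
    refine exists_algebraMap_eq_of_forall_height_one _ fun q hq hq1 => ?_
    obtain ⟨t, ht, htx⟩ := hloc q hq hq1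
    obtain ⟨s, hs⟩ := (h.mem_adjoin_iff hp).1 htx
    have h1 := h.coeff_ext (c := fun i j => t * c i j) (d := fun i j => δ * s i j) (by
      rw [← mul_sum, ← mul_sum, ← hs, hc]
      ring) i j
    refine ⟨t, ht, s i j, ?_⟩
    rw [Algebra.smul_def, mul_div_assoc', eq_div_iff hδL, ← map_mul, ← map_mul, h1, mul_comm]
  choose e he using hcoord
  have he' : ∀ i j, c i j = δ * e i j := fun i j =>
    IsFractionRing.injective S (FractionRing S) (by
      rw [map_mul, he, mul_div_cancel₀ _ hδL])
  refine (h.mem_adjoin_iff hp).2 ⟨e, mul_left_cancel₀ hδK ?_⟩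
  rw [mul_sum, ← hc]
  simp only [he']

theorem isIntegrallyClosed_iff_saturated [IsDomain S] [IsNoetherianRing S] [IsIntegrallyClosed S]
    [FaithfulSMul S K] [Algebra.IsAlgebraic S K] (h : IsKummerPair p f g ω μ) (hp : p.Prime)
    (hpS : Prime (p : S)) (hf0 : f ≠ 0) (hg0 : g ≠ 0) (hf : IsSqFreeElem f) (hg : IsSqFreeElem g)
    (hfg : ∀ q : Ideal S, q.IsPrime → q.height = 1 → f ∈ q → g ∉ q) :
    IsIntegrallyClosed (Algebra.adjoin S {ω, μ}) ↔ ∀ x : K, IsIntegral S x →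
      p * x ∈ Algebra.adjoin S {ω, μ} → x ∈ Algebra.adjoin S {ω, μ} := by
  have hδ : (p : S) ^ 2 * f * g ≠ 0 :=
    mul_ne_zero (mul_ne_zero (pow_ne_zero _ hpS.ne_zero) hf0) hg0
  have := h.isFractionRing_adjoin hp hδ
  have : Algebra.IsIntegral S (Algebra.adjoin S {ω, μ}) := ⟨fun x =>
    (isIntegral_algebraMap_iff (A := Algebra.adjoin S {ω, μ}) (B := K)
      Subtype.val_injective).1 (h.adjoin_le hp x.2)⟩
  rw [isIntegrallyClosed_iff K]
  constructor
  · intro hA x hx _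
    obtain ⟨y, rfl⟩ := hA (hx.tower_top (A := Algebra.adjoin S {ω, μ}))
    exact y.2
  · intro hsat x hx
    replace hx : IsIntegral S x := isIntegral_trans x hx
    refine ⟨⟨x, h.mem_adjoin_of_forall_height_one hp hδ hx fun q hq hq1 => ?_⟩, rfl⟩
    obtain ⟨c, hc, -⟩ := h.coeff_left x hx
    have hδx : algebraMap S K (p ^ 2 * f * g) * x ∈ Algebra.adjoin S {ω, μ} :=
      (h.mem_adjoin_iff hp).2 ⟨c, hc.symm⟩
    by_cases hpq : (p : S) ∈ q
    -- Here `q = (p)`. Splitting the denominator as `p ^ m * d` with `p ∤ d`, saturation removes the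
    -- factors `p` one at a time.
    · obtain ⟨m, d, hd, hm⟩ := WfDvdMonoid.max_power_factor hδ hpS.irreducible
      rw [hm] at hδx
      refine ⟨d, fun hdq => hd ?_, ?_⟩
      · rwa [Ideal.eq_span_singleton_of_height_eq_one hq1 hpq hpS, Ideal.mem_span_singleton] at hdq
      · clear hm
        induction m with
        | zero => simpa using hδx
        | succ m ih =>
          refine ih (hsat _ (isIntegral_algebraMap.mul hx) ?_)
          convert hδx using 1
          simp only [map_mul, map_pow, map_natCast]
          ring
    · by_cases hfq : f ∈ q
      · exact h.exists_mul_mem_of_mem hp q hf0 hfq hpq (hfg q hq hq1 hfq)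
          (fun r hr => hf.exists_dvd_mul hq1 hfq hr) hx
      · by_cases hgq : g ∈ q
        · have := h.swap.exists_mul_mem_of_mem hp q hg0 hgq hpq hfq
            (fun r hr => hg.exists_dvd_mul hq1 hgq hr) hx
          rwa [Set.pair_comm] at this
        · refine ⟨_, fun hm => ?_, hδx⟩
          rcases hq.mem_or_mem hm with hm | hm
          · rcases hq.mem_or_mem hm with hm | hm
            · exact hpq (hq.mem_of_pow_mem _ hm)
            · exact hfq hm
          · exact hgq hm

end IsKummerPair

/-! ### Sufficiency: saturation from the conditions on `f` and `g` -/

theorem natCast_dvd_of_algebraMap {S K : Type*} [CommRing S] [IsDomain S] [IsIntegrallyClosed S]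
    [Field K] [Algebra S K] [FaithfulSMul S K] {A : Subalgebra S K} (hA : A ≤ integralClosure S K)
    {p : ℕ} (hp : (p : S) ≠ 0) (s : S) (h : (p : A) ∣ algebraMap S A s) : (p : S) ∣ s := by
  obtain ⟨b, hb⟩ := h
  exact dvd_of_algebraMap_eq_mul hp (hA b.2) (by simpa using congrArg Subtype.val hb)

theorem algebraMap_mem_powWedge_iff {R : Type*} [CommRing R] [IsDomain R] {p : ℕ} (hp : p.Prime)
    [(pIdeal p R).IsPrime] {g : R} :
    algebraMap R (Localization.AtPrime (pIdeal p R)) g ∈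
        powWedge p 1 2 (Localization.AtPrime (pIdeal p R)) ↔
      ∃ s c d : R, ¬ (p : R) ∣ s ∧ s ^ p * g = c ^ p + p ^ 2 * d := by
  have hinj := IsLocalization.injective (Localization.AtPrime (pIdeal p R))
    (pIdeal p R).primeCompl_le_nonZeroDivisors
  have hmem : ∀ s : R, s ∈ (pIdeal p R).primeCompl ↔ ¬ (p : R) ∣ s := fun s =>
    not_congr Ideal.mem_span_singleton
  constructor
  · rintro ⟨x, y, hxy⟩
    obtain ⟨⟨c, s⟩, hc⟩ := IsLocalization.surj (pIdeal p R).primeCompl x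
    obtain ⟨⟨d, t⟩, hd⟩ := IsLocalization.surj (pIdeal p R).primeCompl y
    obtain ⟨m, rfl⟩ := Nat.exists_eq_add_one_of_ne_zero hp.ne_zero
    -- With `x = c / s`, `y = d / t` and `p = m + 1`, this multiplies the equation by `(s * t) ^ p`.
    refine ⟨s * t, c * t, d * s ^ (m + 1) * t ^ m, (hmem _).1 (s * t).2, hinj ?_⟩
    simp only [pow_one] at hxy hc hd
    simp only [map_add, map_mul, map_pow, ← hc, ← hd, hxy, map_natCast]
    ring
  · rintro ⟨s, c, d, hs, h⟩
    have hu := IsLocalization.map_units (Localization.AtPrime (pIdeal p R))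
      (⟨s, (hmem s).2 hs⟩ : (pIdeal p R).primeCompl)
    obtain ⟨u, hu⟩ := hu
    have h1 := congrArg (algebraMap R (Localization.AtPrime (pIdeal p R))) h
    simp only [map_add, map_mul, map_pow, map_natCast] at h1
    change (u : Localization.AtPrime (pIdeal p R)) = algebraMap R _ s at hu
    rw [← hu] at h1
    refine ⟨algebraMap R _ c * ↑u⁻¹, algebraMap R _ d * (↑u⁻¹) ^ p, ?_⟩
    have h2 : (u : Localization.AtPrime (pIdeal p R)) ^ p * (↑u⁻¹) ^ p = 1 := by
      rw [← mul_pow, Units.mul_inv, one_pow]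
    rw [pow_one, mul_pow]
    linear_combination (↑u⁻¹) ^ p * h1 - algebraMap R (Localization.AtPrime (pIdeal p R)) g * h2

namespace IsKummerPair

variable {S K : Type*} [CommRing S] [IsDomain S] [IsIntegrallyClosed S] [Field K] [Algebra S K]
  [FaithfulSMul S K] {p : ℕ} {f g : S} {ω μ : K}

/-- The powers of `ω` are independent modulo `p`. This serves both to show that `p` generates a
radical ideal and to contract divisibility by `p` from the integral closure to `S[ω]`. -/
theorem dvd_of_pow_eq (h : IsKummerPair p f g ω μ) (hp : p.Prime) (hpS : Prime (p : S))
    [IsIntegrallyClosed (S ⧸ pIdeal p S)] (hf : f ∉ frobLift p S) (r : Algebra.adjoin S {ω}) {y : K}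
    (hy : IsIntegral S y) (hr : (r : K) ^ p = p * y) : (p : Algebra.adjoin S {ω}) ∣ r := by
  obtain ⟨c, hc⟩ := (h.mem_adjoin_left_iff hp).1 r.2
  have h1 := dvd_of_dvd_sum_of_not_pow hp hpS (algebraMap S (integralClosure S K))
    (natCast_dvd_of_algebraMap le_rfl hpS.ne_zero) (dvd_of_not_mem_frobLift hp hpS hf)
    (μ := ⟨ω, h.isIntegral_left hp⟩) (Subtype.ext (by simpa using h.pow_left)) c
    ⟨⟨y, hy⟩, Subtype.ext (by simpa [← hc] using hr)⟩
  choose d hd using h1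
  refine ⟨⟨_, (h.mem_adjoin_left_iff hp).2 ⟨d, rfl⟩⟩, Subtype.ext ?_⟩
  simp only [hc, hd, map_mul, map_natCast, MulMemClass.coe_mul, Finset.mul_sum, mul_assoc]
  rfl

theorem isPrime_pIdeal_left (h : IsKummerPair p f g ω μ) (hp : p.Prime) (hpS : Prime (p : S))
    [IsIntegrallyClosed (S ⧸ pIdeal p S)] (hf : f ∉ frobLift p S) :
    (pIdeal p (Algebra.adjoin S {ω})).IsPrime := by
  have hS := natCast_dvd_of_algebraMap (h.adjoin_left_le hp) hpS.ne_zero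
  have hrad := isPrime_radical_pIdeal hp.ne_zero hpS (h.exists_pow_eq_left hp) hS
  have heq : (pIdeal p (Algebra.adjoin S {ω})).radical = pIdeal p (Algebra.adjoin S {ω}) := by
    refine le_antisymm (fun r hr => ?_) Ideal.le_radical
    obtain ⟨s, b, hsb⟩ := h.exists_pow_eq_left hp r
    obtain ⟨c, rfl⟩ := (mem_radical_pIdeal_iff hp.ne_zero hsb hpS hS).1 hr
    refine Ideal.mem_span_singleton.2 (h.dvd_of_pow_eq hp hpS hf r
      (y := algebraMap S K c + b) (isIntegral_algebraMap.add (h.adjoin_left_le hp b.2)) ?_)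
    have := congrArg Subtype.val hsb
    simp only [map_mul, map_natCast] at this
    rw [mul_add]
    exact this
  exact heq ▸ hrad

/-- If `f` is not a `p`-th power modulo `p` and `g` is not congruent to a `p`-th power modulo `p²`
in `S[ω]_(p)`, then `S[ω, μ]` is `p`-saturated in its integral closure. -/
theorem saturated (h : IsKummerPair p f g ω μ) (hp : p.Prime) (hpS : Prime (p : S))
    [IsIntegrallyClosed (S ⧸ pIdeal p S)] (hf : f ∉ frobLift p S)
    (hg : ¬ ∃ s c d : Algebra.adjoin S {ω}, ¬ (p : Algebra.adjoin S {ω}) ∣ s ∧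
      s ^ p * algebraMap S _ g = c ^ p + p ^ 2 * d) {x : K} (hx : IsIntegral S x)
    (hpx : p * x ∈ Algebra.adjoin S {ω, μ}) : x ∈ Algebra.adjoin S {ω, μ} := by
  have hpK : (p : K) ≠ 0 := fun h0 => hpS.ne_zero
    (FaithfulSMul.algebraMap_injective S K (by simpa using h0))
  have hpT : (p : Algebra.adjoin S {ω}) ≠ 0 := fun h0 => hpK (by simpa using congrArg Subtype.val h0)
  obtain ⟨t, ht⟩ := (h.mem_adjoin_iff_exists_left hp).1 hpx
  have hprime := h.isPrime_pIdeal_left hp hpS hf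
  have hpP : Prime (p : Algebra.adjoin S {ω}) := (Ideal.span_singleton_prime hpT).1 hprime
  let φ : Algebra.adjoin S {ω} →+* integralClosure S K :=
    (Subalgebra.inclusion (h.adjoin_left_le hp)).toRingHom
  have hφv : ∀ r, (φ r : K) = r := fun r => rfl
  have hφ : ∀ r, (p : integralClosure S K) ∣ φ r → (p : Algebra.adjoin S {ω}) ∣ r := by
    rintro r ⟨y, hy⟩
    refine h.dvd_of_pow_eq hp hpS hf r (y := p ^ (p - 1) * (y : K) ^ p) ?_ ?_
    · exact (p ^ (p - 1) * y ^ p : integralClosure S K).2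
    · have h1 : (φ r : K) = p * (y : K) := by simpa using congrArg Subtype.val hy
      rw [hφv] at h1
      rw [h1, mul_pow, ← mul_pow_sub_one hp.ne_zero, mul_assoc]
  let m : integralClosure S K := ⟨μ, h.swap.isIntegral_left hp⟩
  have hm : m ^ p = φ (algebraMap S _ g) := Subtype.ext h.pow_right
  have hsum : (p : integralClosure S K) ∣ ∑ j, φ (t j) * m ^ (j : ℕ) :=
    ⟨⟨x, hx⟩, Subtype.ext (by simpa [hφv, m] using ht.symm)⟩
  have hdvd : ∀ j, (p : Algebra.adjoin S {ω}) ∣ t j := by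
    -- The dichotomy is whether `g` becomes a `p`-th power in the fraction field of `S[ω] / p`.
    by_cases hγ : ∀ a b : Algebra.adjoin S {ω},
        (p : Algebra.adjoin S {ω}) ∣ a ^ p - algebraMap S _ g * b ^ p →
          (p : Algebra.adjoin S {ω}) ∣ b
    · exact dvd_of_dvd_sum_of_not_pow hp hpP φ hφ hγ hm t (dvd_pow hsum hp.ne_zero)
    · push Not at hγ
      obtain ⟨c, s, ⟨d, hd⟩, hs⟩ := hγ
      have hd' : ¬ (p : Algebra.adjoin S {ω}) ∣ d := by
        rintro ⟨e, rfl⟩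
        exact hg ⟨s, c, -e, hs, by linear_combination -hd⟩
      -- Expanding `(z + c) ^ p = s ^ p * g = c ^ p - p * d` gives an Eisenstein equation for `z`,
      -- since `p ∤ d`.
      let z := φ s * m - φ c
      obtain ⟨r, hr⟩ := exists_add_pow_prime_eq hp z (φ c)
      have hz : z ^ p = φ p * (φ (-d) + z * (-(φ c * r))) := by
        have h1 : (z + φ c) ^ p = φ (s ^ p * algebraMap S _ g) := by
          rw [sub_add_cancel, mul_pow, hm, ← map_pow, ← map_mul]
        rw [show s ^ p * algebraMap S _ g = c ^ p - p * d by linear_combination -hd, hr] at h1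
        simp only [map_sub, map_mul, map_pow, map_natCast, map_neg] at h1 ⊢
        linear_combination h1
      -- The powers of `s` make the value of `P` at `s * μ = z + c` equal to `s ^ (p - 1)` times the
      -- given sum; its Taylor shift by `c` is then an expansion in powers of `z`.
      let P : (Algebra.adjoin S {ω})[X] := ∑ j : Fin p, C (t j * s ^ (p - 1 - j)) * X ^ (j : ℕ)
      have hPdeg : P.degree < p := by
        refine (degree_sum_le _ _).trans_lt
          ((Finset.sup_lt_iff (WithBot.bot_lt_coe p)).2 fun j _ => ?_)
        exact (degree_C_mul_X_pow_le _ _).trans_lt (Nat.cast_lt.2 j.2)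
      have hPeval : eval₂ φ (z + φ c) P = φ s ^ (p - 1) * ∑ j, φ (t j) * m ^ (j : ℕ) := by
        simp only [P, eval₂_finsetSum, eval₂_mul, eval₂_pow, eval₂_C, eval₂_X, Finset.mul_sum, z,
          sub_add_cancel, map_mul, map_pow, mul_pow]
        refine Finset.sum_congr rfl fun j _ => ?_
        have : φ s ^ (p - 1) = φ s ^ (p - 1 - j) * φ s ^ (j : ℕ) := by
          rw [← pow_add]
          congr 1
          omega
        rw [this]
        ring
      have hteval : eval₂ φ z (taylor c P) =
          ∑ j : Fin p, φ ((taylor c P).coeff j) * z ^ (j : ℕ) := by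
        rw [eval₂_eq_sum_range' (n := p), Finset.sum_range]
        by_cases hP0 : P = 0
        · simp [hP0, hp.pos]
        · rw [natDegree_taylor]
          exact (natDegree_lt_iff_degree_lt hP0).2 hPdeg
      have hcoeff : ∀ j : Fin p, (taylor c P).coeff j ∈ pIdeal p (Algebra.adjoin S {ω}) := by
        refine mem_of_dvd_sum_of_eisenstein φ _ (π := (p : Algebra.adjoin S {ω})) ?_ ?_ ?_ ?_ hz
          (fun j => (taylor c P).coeff j) ?_
        · rw [map_natCast]
          exact fun h0 => hpK (by simpa using congrArg Subtype.val h0)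
        · exact fun r hr => ⟨1, fun h1 => hprime.ne_top ((Ideal.eq_top_iff_one _).2 h1),
            by rwa [one_mul, ← Ideal.mem_span_singleton]⟩
        · intro r hr
          rw [map_natCast] at hr
          exact Ideal.mem_span_singleton.2 (hφ r hr)
        · rw [Ideal.mem_span_singleton, dvd_neg]
          exact hd'
        · rw [← hteval, taylor_apply, eval₂_comp, eval₂_add, eval₂_X, eval₂_C, hPeval, map_natCast]
          exact dvd_mul_of_dvd_right hsum _
      have hC : C (p : Algebra.adjoin S {ω}) ∣ taylor c P := by
        rw [C_dvd_iff_dvd_coeff]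
        intro j
        by_cases hj : j < p
        · exact Ideal.mem_span_singleton.1 (hcoeff ⟨j, hj⟩)
        · rw [coeff_eq_zero_of_degree_lt]
          · exact dvd_zero _
          · rw [degree_taylor]
            exact hPdeg.trans_le (Nat.cast_le.2 (not_lt.1 hj))
      -- Shifting back by `-c` preserves divisibility by the constant `p`.
      have hC' : C (p : Algebra.adjoin S {ω}) ∣ P := by
        obtain ⟨Q, hQ⟩ := hC
        refine ⟨taylor (-c) Q, ?_⟩
        have := congrArg (taylor (-c)) hQ
        rwa [taylor_taylor, neg_add_cancel, taylor_zero, taylor_mul, taylor_C] at this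
      intro j
      have h1 := (C_dvd_iff_dvd_coeff _ _).1 hC' j
      simp only [P, finsetSum_coeff, coeff_C_mul, coeff_X_pow] at h1
      rw [Finset.sum_eq_single j (fun i _ hij => by simp [Fin.val_inj, hij.symm]) (by simp)] at h1
      simp only [if_true, mul_one] at h1
      exact (hpP.dvd_or_dvd h1).resolve_right fun h2 => hs (hpP.dvd_of_dvd_pow h2)
  choose u hu using hdvd
  refine (h.mem_adjoin_iff_exists_left hp).2 ⟨u, mul_left_cancel₀ hpK ?_⟩
  rw [ht, Finset.mul_sum]
  refine Finset.sum_congr rfl fun j _ => ?_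
  rw [hu, ← mul_assoc]
  rfl

end IsKummerPair

/-! ### Necessity: integral elements outside `A` -/

namespace IsKummerPair

section

variable {S K : Type*} [CommRing S] [IsDomain S] [Field K] [Algebra S K] {p : ℕ} {f g : S}
  {ω μ : K}

/-- With `z = s * μ - c`, the witness is `z ^ (p - 1) / p`. From `z ^ p = p * (p * d - z * c * r)`
it is a root of `X ^ 2 + c * r * X - d * z ^ (p - 2)`. -/
theorem not_saturated_of_pow_add_sq (h : IsKummerPair p f g ω μ) (hp : p.Prime) (hpK : (p : K) ≠ 0)
    (hpT : Prime (p : Algebra.adjoin S {ω})) {s c d : Algebra.adjoin S {ω}}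
    (hs : ¬ (p : Algebra.adjoin S {ω}) ∣ s)
    (hg : s ^ p * algebraMap S _ g = c ^ p + p ^ 2 * d) :
    ∃ x : K, IsIntegral S x ∧ p * x ∈ Algebra.adjoin S {ω, μ} ∧
      x ∉ Algebra.adjoin S {ω, μ} := by
  let B := integralClosure S K
  have hT : ∀ r : Algebra.adjoin S {ω}, IsIntegral S (r : K) := fun r => h.adjoin_left_le hp r.2
  have hTA : ∀ r : Algebra.adjoin S {ω}, (r : K) ∈ Algebra.adjoin S {ω, μ} := fun r =>
    Algebra.adjoin_mono (by simp) r.2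
  let z : B := ⟨s * μ - c, ((hT s).mul (h.swap.isIntegral_left hp)).sub (hT c)⟩
  let c' : B := ⟨c, hT c⟩
  let d' : B := ⟨d, hT d⟩
  obtain ⟨r, hr⟩ := exists_add_pow_prime_eq hp z c'
  obtain ⟨n, rfl⟩ : ∃ n, p = n + 2 := Nat.exists_eq_add_of_le' hp.two_le
  have hz : z ^ (n + 2) = (n + 2 : ℕ) * ((n + 2 : ℕ) * d' - z * c' * r) := by
    have h1 : (z + c') ^ (n + 2) = c' ^ (n + 2) + (n + 2 : ℕ) ^ 2 * d' := by
      refine Subtype.ext ?_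
      have h2 := congrArg Subtype.val hg
      simp only [z, c', d'] at h2 ⊢
      push_cast at h2 ⊢
      rw [sub_add_cancel, mul_pow, h.pow_right]
      exact h2
    linear_combination hr.symm.trans h1
  have hzK := congrArg Subtype.val hz
  simp only [MulMemClass.coe_mul, SubmonoidClass.coe_pow, AddSubgroupClass.coe_sub,
    SubringClass.coe_natCast] at hzK
  have hzv : (z : K) = s * μ - c := rfl
  refine ⟨(z : K) ^ (n + 1) / (n + 2 : ℕ), ?_, ?_, ?_⟩
  · let P : B[X] := X ^ 2 + (C (c' * r) * X - C (d' * z ^ n))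
    have hP : P.Monic := by
      refine monic_X_pow_add ((degree_sub_le _ _).trans_lt (max_lt ?_ ?_))
      · exact (degree_C_mul_X_le _).trans_lt (by norm_num)
      · exact degree_C_le.trans_lt (by norm_num)
    refine isIntegral_trans (A := B) _ ⟨P, hP, ?_⟩
    simp only [P, eval₂_add, eval₂_sub, eval₂_mul, eval₂_pow, eval₂_X, eval₂_C]
    change ((z : K) ^ (n + 1) / (n + 2 : ℕ)) ^ 2 + ((c' * r : B) *
      ((z : K) ^ (n + 1) / (n + 2 : ℕ)) - (d' * z ^ n : B)) = 0
    simp only [MulMemClass.coe_mul, SubmonoidClass.coe_pow]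
    field_simp
    linear_combination (z : K) ^ n * hzK
  · rw [mul_div_cancel₀ _ hpK]
    exact pow_mem (sub_mem (mul_mem (hTA s) (Algebra.subset_adjoin (by simp))) (hTA c)) _
  · intro hmem
    obtain ⟨t, ht⟩ := (h.mem_adjoin_iff_exists_left hp).1 hmem
    rw [div_eq_iff hpK, mul_comm, Finset.mul_sum, hzv, sub_eq_add_neg, add_pow,
      Finset.sum_range] at ht
    have h1 := h.coeff_left_ext hp
      (t := fun j => s ^ (j : ℕ) * (-c) ^ (n + 1 - j) * ((n + 1).choose j))
      (u := fun j => (n + 2 : ℕ) * t j) (by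
        convert ht using 2 with j _ j _
        · push_cast
          ring
        · rw [← mul_assoc]
          rfl)
    -- The coefficient of `μ ^ (p - 1)` in `z ^ (p - 1)` is `s ^ (p - 1)`, which the prime `p` does
    -- not divide.
    have h2 := congrFun h1 (Fin.last _)
    simp at h2
    exact hs (hpT.dvd_of_dvd_pow (n := n + 1) ⟨_, by push_cast; exact h2⟩)

/-- Both `(ω - a) ^ p` and `(μ - c) ^ p` are `p` times integral elements, so `(ω - a) ^ (p - 1) * (μ
- c) / p` has an integral `p`-th power. -/
theorem not_saturated_of_pow_add (h : IsKummerPair p f g ω μ) (hp : p.Prime) (hpK : (p : K) ≠ 0)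
    (hpS : ¬ IsUnit (p : S)) {a b c d : S} (hf : f - a ^ p = p * b) (hg : g - c ^ p = p * d) :
    ∃ x : K, IsIntegral S x ∧ p * x ∈ Algebra.adjoin S {ω, μ} ∧
      x ∉ Algebra.adjoin S {ω, μ} := by
  let B := integralClosure S K
  have key : ∀ {f a b : S} {ω : K}, IsIntegral S ω → ω ^ p = algebraMap S K f →
      f - a ^ p = p * b → ∃ r : K, IsIntegral S r ∧ (ω - algebraMap S K a) ^ p = p * r := by
    intro f a b ω hωi hω hf
    let z : B := ⟨ω, hωi⟩ - algebraMap S B a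
    obtain ⟨r, hr⟩ := exists_add_pow_prime_eq hp z (algebraMap S B a)
    have h1 : z ^ p = p * (algebraMap S B b - z * algebraMap S B a * r) := by
      have h2 : (z + algebraMap S B a) ^ p = algebraMap S B f := by
        rw [sub_add_cancel]
        exact Subtype.ext hω
      have h3 := congrArg (algebraMap S B) hf
      simp only [map_sub, map_mul, map_pow, map_natCast] at h3
      linear_combination h2 - hr + h3
    exact ⟨_, (algebraMap S B b - z * algebraMap S B a * r).2, by
      have h4 := congrArg Subtype.val h1
      simp only [SubmonoidClass.coe_pow, MulMemClass.coe_mul, SubringClass.coe_natCast] at h4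
      exact h4⟩
  obtain ⟨r, hri, hr⟩ := key (h.isIntegral_left hp) h.pow_left hf
  obtain ⟨u, hui, hu⟩ := key (h.swap.isIntegral_left hp) h.pow_right hg
  obtain ⟨n, rfl⟩ : ∃ n, p = n + 2 := Nat.exists_eq_add_of_le' hp.two_le
  have hA : ∀ s : S, algebraMap S K s ∈ Algebra.adjoin S {ω, μ} :=
    fun s => Subalgebra.algebraMap_mem _ s
  refine ⟨(ω - algebraMap S K a) ^ (n + 1) * (μ - algebraMap S K c) / (n + 2 : ℕ), ?_, ?_, ?_⟩
  · refine IsIntegral.of_pow hp.pos (?_ : IsIntegral S (_ ^ (n + 2)))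
    have h1 : ((ω - algebraMap S K a) ^ (n + 1) * (μ - algebraMap S K c) / (n + 2 : ℕ)) ^ (n + 2) =
        r ^ (n + 1) * u := by
      rw [div_pow, div_eq_iff (pow_ne_zero _ hpK), mul_pow, ← pow_mul, mul_comm (n + 1), pow_mul,
        hr, hu]
      ring
    rw [h1]
    exact (hri.pow _).mul hui
  · rw [mul_div_cancel₀ _ hpK]
    exact mul_mem (pow_mem (sub_mem (Algebra.subset_adjoin (by simp)) (hA a)) _)
      (sub_mem (Algebra.subset_adjoin (by simp)) (hA c))
  · intro hmem
    obtain ⟨e, he⟩ := (h.mem_adjoin_iff hp).1 hmem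
    rw [div_eq_iff hpK, mul_comm _ ((n + 2 : ℕ) : K), ← map_natCast (algebraMap S K), mul_sum,
      sub_eq_add_neg, add_pow, Finset.sum_range] at he
    have h1 := h.coeff_ext
      (c := fun i j => (-a) ^ (n + 1 - i) * ((n + 1).choose i) *
        ((if (j : ℕ) = 1 then 1 else 0) + (if (j : ℕ) = 0 then -c else 0)))
      (d := fun i j => (n + 2 : ℕ) * e i j) (by
        have h2 : ∑ j : Fin (n + 2), algebraMap S K ((if (j : ℕ) = 1 then 1 else 0) +
            (if (j : ℕ) = 0 then -c else 0)) * μ ^ (j : ℕ) = μ - algebraMap S K c := by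
          rw [Fin.sum_univ_succ, Fin.sum_univ_succ]
          simp [sub_eq_neg_add]
        rw [← he, ← h2, Finset.mul_sum]
        refine Finset.sum_congr rfl fun j _ => ?_
        rw [← mul_assoc, Finset.sum_mul, Finset.sum_mul, Finset.sum_mul]
        refine Finset.sum_congr rfl fun i _ => ?_
        rw [map_mul, map_mul, map_pow, map_neg, map_natCast]
        ring) (Fin.last _) 1
    -- The coefficient of `ω ^ (p - 1) * μ` in the numerator is `1`, so membership in `A` would make
    -- `p` a unit.
    simp at h1
    exact hpS (isUnit_iff_dvd_one.2 ⟨_, by push_cast; exact h1⟩)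

end

end IsKummerPair

/-! ### Localization at the prime over `p` -/

theorem isDiscreteValuationRing_localization_of_height_eq_one {A : Type*} [CommRing A] [IsDomain A]
    [IsNoetherianRing A] [IsIntegrallyClosed A] (P : Ideal A) [P.IsPrime] (hP : P.height = 1) :
    IsDiscreteValuationRing (Localization.AtPrime P) := by
  have hdom := IsLocalization.isDomain_localization P.primeCompl_le_nonZeroDivisors
  have hnoeth : IsNoetherianRing (Localization.AtPrime P) :=
    IsLocalization.isNoetherianRing P.primeCompl _ inferInstance
  have hic : IsIntegrallyClosed (Localization.AtPrime P) :=
    isIntegrallyClosed_of_isLocalization _ P.primeCompl P.primeCompl_le_nonZeroDivisors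
  have hm : (IsLocalRing.maximalIdeal (Localization.AtPrime P)).height = 1 := by
    have h1 := IsLocalization.AtPrime.ringKrullDim_eq_height P (Localization.AtPrime P)
    rw [← IsLocalRing.maximalIdeal_height_eq_ringKrullDim, hP] at h1
    exact_mod_cast h1
  have hne := Ideal.ne_bot_of_height_eq_one hm
  have hfield : ¬ IsField (Localization.AtPrime P) := fun h =>
    hne ((IsLocalRing.isField_iff_maximalIdeal_eq).1 h)
  have htfae := (IsDiscreteValuationRing.TFAE _ hfield).out 0 3
  refine htfae.2 ⟨hic, _,
    ⟨hne, inferInstance⟩, fun Q ⟨hQ0, hQ⟩ => ?_⟩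
  by_contra hQm
  have := Ideal.height_strict_mono_of_isPrime (lt_of_le_of_ne
    (IsLocalRing.le_maximalIdeal hQ.ne_top) hQm)
  rw [hm, Order.lt_one_iff, Ideal.height_eq_zero_iff_eq_bot] at this
  exact hQ0 this

/-- An element of the fraction field of `A` that is integral over `A` has a denominator outside any
prime at which the localization of `A` is integrally closed. -/
theorem exists_mul_mem_of_isIntegrallyClosed_localization {A K : Type*} [CommRing A] [IsDomain A]
    [Field K] [Algebra A K] [IsFractionRing A K] (P : Ideal A) [P.IsPrime]
    [IsIntegrallyClosed (Localization.AtPrime P)] {x : K} (hx : IsIntegral A x) :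
    ∃ s ∉ P, ∃ a, algebraMap A K s * x = algebraMap A K a := by
  have hu : ∀ s : P.primeCompl, IsUnit (algebraMap A K s) := fun s =>
    IsUnit.mk0 _ fun h0 => s.2 (by
      rw [IsFractionRing.injective A K (h0.trans (map_zero _).symm)]
      exact zero_mem P)
  let _ : Algebra (Localization.AtPrime P) K := (IsLocalization.lift hu).toAlgebra
  have : IsScalarTower A (Localization.AtPrime P) K :=
    IsScalarTower.of_algebraMap_eq fun a => (IsLocalization.lift_eq hu a).symm
  have := IsFractionRing.isFractionRing_of_isDomain_of_isLocalization P.primeCompl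
    (Localization.AtPrime P) K
  obtain ⟨z, rfl⟩ := (isIntegrallyClosed_iff K).1 ‹_› (hx.tower_top (A := Localization.AtPrime P))
  obtain ⟨⟨a, s⟩, has⟩ := IsLocalization.surj P.primeCompl z
  refine ⟨s, s.2, a, ?_⟩
  rw [IsScalarTower.algebraMap_apply A (Localization.AtPrime P) K a, ← has, map_mul,
    ← IsScalarTower.algebraMap_apply, mul_comm]

namespace IsKummerPair

variable {S K : Type*} [CommRing S] [IsDomain S] [Field K] [Algebra S K] {p : ℕ} {f g : S}
  {ω μ : K}

/-- From `s * x = a` with `s ∉ P` and `s ^ p = t + p * b`, multiplying by `s ^ (p - 1)` puts `t * x`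
in `A`, where `t ∈ S` is prime to `p`. -/
theorem saturated_of_isIntegrallyClosed_localization (h : IsKummerPair p f g ω μ) (hp : p.Prime)
    (hpS : Prime (p : S)) [FaithfulSMul S K] [IsFractionRing (Algebra.adjoin S {ω, μ}) K]
    (P : Ideal (Algebra.adjoin S {ω, μ})) [hP : P.IsPrime]
    (hpP : (p : Algebra.adjoin S {ω, μ}) ∈ P) [IsIntegrallyClosed (Localization.AtPrime P)] {x : K}
    (hx : IsIntegral S x) (hpx : p * x ∈ Algebra.adjoin S {ω, μ}) :
    x ∈ Algebra.adjoin S {ω, μ} := by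
  obtain ⟨s, hs, a, ha⟩ := exists_mul_mem_of_isIntegrallyClosed_localization P
    (hx.tower_top (A := Algebra.adjoin S {ω, μ}))
  obtain ⟨t, b, htb⟩ := h.exists_pow_eq hp s
  have hpt : ¬ (p : S) ∣ t := by
    rintro ⟨u, rfl⟩
    refine hs (hP.mem_of_pow_mem p ?_)
    rw [htb, map_mul, map_natCast]
    exact add_mem (P.mul_mem_right _ hpP) (P.mul_mem_right _ hpP)
  refine h.mem_adjoin_of_mul_mem hp hpS hpt (by rwa [map_natCast]) ?_ fun h0 =>
    hpS.ne_zero (FaithfulSMul.algebraMap_injective S K (h0.trans (map_zero _).symm))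
  have h1 : algebraMap S K t * x = (s : K) ^ (p - 1) * a - b * (p * x) := by
    have h2 : (s : K) ^ p = algebraMap S K t + p * b := by
      simpa using congrArg Subtype.val htb
    have h3 : (s : K) * x = a := ha
    rw [← mul_pow_sub_one hp.ne_zero] at h2
    linear_combination (-x) * h2 + (s : K) ^ (p - 1) * h3
  rw [h1]
  exact sub_mem (mul_mem (pow_mem s.2 _) a.2) (mul_mem b.2 hpx)

end IsKummerPair

/-! ### The main theorem -/

theorem proposition2p9
    {S L K : Type*} [CommRing S] [IsDomain S] [IsNoetherianRing S] [IsIntegrallyClosed S]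
    [Field L] [CharZero L] [Algebra S L] [IsFractionRing S L]
    [Field K] [Algebra L K] [Algebra S K] [IsScalarTower S L K]
    (p : ℕ) (hp : p.Prime) (hpS : Prime (p : S)) (hSp : IsIntegrallyClosed (S ⧸ pIdeal p S))
    (f g : S) (hf : ¬ ∃ x : S, f = x ^ p) (hg : ¬ ∃ x : S, g = x ^ p)
    (hfsq : IsSqFreeElem f) (hgsq : IsSqFreeElem g) (hA1 : SatisfiesA1 ({f, g} : Set S))
    (ω μ : K) (hω : ω ^ p = algebraMap S K f) (hμ : μ ^ p = algebraMap S K g)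
    (hirr : Irreducible (Polynomial.X ^ p -
      Polynomial.C (algebraMap L (IntermediateField.adjoin L {ω}) (algebraMap S L g))))
    (hK : IntermediateField.adjoin L {ω, μ} = ⊤) :
    -- there is a unique height one prime of `A = S[ω, μ]` containing `p`
    (∃! P : Ideal (Algebra.adjoin S {ω, μ}),
      P.IsPrime ∧ P.height = 1 ∧ (p : Algebra.adjoin S {ω, μ}) ∈ P) ∧
    -- `A` is integrally closed iff `A_P` is a DVR, for that prime `P`
    (∀ (P : Ideal (Algebra.adjoin S {ω, μ})) [P.IsPrime],
      P.height = 1 → (p : Algebra.adjoin S {ω, μ}) ∈ P →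
        (IsIntegrallyClosed (Algebra.adjoin S {ω, μ}) ↔
          IsDiscreteValuationRing (Localization.AtPrime P))) ∧
    -- the localizations `S[ω]_(p)`, `S[μ]_(p)` make sense where they are used ...
    (f ∉ frobLift p S → (pIdeal p (Algebra.adjoin S {ω})).IsPrime) ∧
    (g ∉ frobLift p S → (pIdeal p (Algebra.adjoin S {μ})).IsPrime) ∧
    -- ... and the criterion for `A` to be integrally closed
    (IsIntegrallyClosed (Algebra.adjoin S {ω, μ}) ↔
      (f ∉ frobLift p S ∧ ∃ _ : (pIdeal p (Algebra.adjoin S {ω})).IsPrime,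
        algebraMap (Algebra.adjoin S {ω}) (Localization.AtPrime (pIdeal p (Algebra.adjoin S {ω})))
            (algebraMap S (Algebra.adjoin S {ω}) g) ∉
          powWedge p 1 2 (Localization.AtPrime (pIdeal p (Algebra.adjoin S {ω})))) ∨
      (g ∉ frobLift p S ∧ ∃ _ : (pIdeal p (Algebra.adjoin S {μ})).IsPrime,
        algebraMap (Algebra.adjoin S {μ}) (Localization.AtPrime (pIdeal p (Algebra.adjoin S {μ})))
            (algebraMap S (Algebra.adjoin S {μ}) f) ∉
          powWedge p 1 2 (Localization.AtPrime (pIdeal p (Algebra.adjoin S {μ}))))) := by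
  have hfaith : FaithfulSMul S K := (faithfulSMul_iff_algebraMap_injective S K).2 (by
    rw [IsScalarTower.algebraMap_eq S L K]
    exact (algebraMap L K).injective.comp (IsFractionRing.injective S L))
  have h := isKummerPair_of_irreducible hp hf hg hω hμ hirr hK
  have halg : Algebra.IsAlgebraic S K := by
    have h1 : Algebra.IsAlgebraic L (IntermediateField.adjoin L {ω, μ}) :=
      IntermediateField.isAlgebraic_adjoin (by
        rintro x (rfl | rfl)
        · exact (h.isIntegral_left hp).tower_top
        · exact (h.swap.isIntegral_left hp).tower_top)
    rw [hK] at h1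
    have h2 : Algebra.IsAlgebraic L K := by
      refine ⟨fun x => ?_⟩
      exact (isAlgebraic_algebraMap_iff (A := K)
        (algebraMap (⊤ : IntermediateField L K) K).injective).2
        (h1.isAlgebraic ⟨x, trivial⟩)
    exact (IsFractionRing.comap_isAlgebraic_iff (A := S) (K := L) (C := K)).2 h2
  have hf0 : f ≠ 0 := fun h0 => hf ⟨0, by rw [h0, zero_pow hp.ne_zero]⟩
  have hg0 : g ≠ 0 := fun h0 => hg ⟨0, by rw [h0, zero_pow hp.ne_zero]⟩
  -- If `f = g`, then `ω` would be a root of `U ^ p - g` in `L(ω)`, against irreducibility; so the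
  -- coprimality hypothesis applies.
  have hfg : f ≠ g := by
    rintro rfl
    refine (X_pow_sub_C_irreducible_iff_of_prime hp).1 hirr
      (IntermediateField.AdjoinSimple.gen L ω) ((algebraMap _ K).injective ?_)
    rw [map_pow, IntermediateField.AdjoinSimple.algebraMap_gen, hω,
      ← IsScalarTower.algebraMap_apply L _ K, IsScalarTower.algebraMap_apply S L K]
  have hpK : (p : K) ≠ 0 := fun h0 => hpS.ne_zero
    (FaithfulSMul.algebraMap_injective S K (by simpa using h0))
  have hS := natCast_dvd_of_algebraMap (h.adjoin_le hp) hpS.ne_zero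
  have hnoeth : IsNoetherianRing (Algebra.adjoin S {ω, μ}) :=
    isNoetherianRing_of_fg (Subalgebra.fg_def.2 ⟨_, Set.toFinite _, rfl⟩)
  have hfrac := h.isFractionRing_adjoin hp
    (mul_ne_zero (mul_ne_zero (pow_ne_zero 2 hpS.ne_zero) hf0) hg0)
  have hiff := h.isIntegrallyClosed_iff_saturated hp hpS hf0 hg0 hfsq hgsq
    fun q hq hq1 hfq hgq => hA1 f (by simp) g (by simp) hfg ⟨q, hq, hq1, hfq, hgq⟩
  have hprimeω := h.isPrime_pIdeal_left hp hpS
  have hprimeμ := h.swap.isPrime_pIdeal_left hp hpS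
  -- Stated for an arbitrary pair so that it also applies with `ω` and `μ` exchanged.
  have hnecessary : ∀ {f g : S} {ω μ : K}, IsKummerPair p f g ω μ →
      (∀ x : K, IsIntegral S x → p * x ∈ Algebra.adjoin S {ω, μ} →
        x ∈ Algebra.adjoin S {ω, μ}) → ∀ _ : (pIdeal p (Algebra.adjoin S {ω})).IsPrime,
      algebraMap (Algebra.adjoin S {ω}) (Localization.AtPrime (pIdeal p (Algebra.adjoin S {ω})))
          (algebraMap S (Algebra.adjoin S {ω}) g) ∉
        powWedge p 1 2 (Localization.AtPrime (pIdeal p (Algebra.adjoin S {ω}))) := by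
    intro f g ω μ h hsat hprime hmem
    obtain ⟨s, c, d, hs, hscd⟩ := (algebraMap_mem_powWedge_iff hp).1 hmem
    have hpT : Prime (p : Algebra.adjoin S {ω}) :=
      (Ideal.span_singleton_prime fun h0 => hpK (by simpa using congrArg Subtype.val h0)).1 hprime
    obtain ⟨x, hx, hpx, hxA⟩ := h.not_saturated_of_pow_add_sq hp hpK hpT hs hscd
    exact hxA (hsat x hx hpx)
  refine ⟨existsUnique_height_one_of_mem
    (fun h0 => hpK (by simpa using congrArg Subtype.val h0))
    (isPrime_radical_pIdeal hp.ne_zero hpS (h.exists_pow_eq hp) hS), fun P hP hP1 hpP => ?_,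
    hprimeω, hprimeμ, ?_⟩
  · constructor
    · intro hA
      exact isDiscreteValuationRing_localization_of_height_eq_one P hP1
    · intro hdvr
      exact hiff.2 fun x hx hpx =>
        h.saturated_of_isIntegrallyClosed_localization hp hpS P hpP hx hpx
  · rw [hiff]
    constructor
    · intro hsat
      by_cases hfp : f ∈ frobLift p S
      · by_cases hgp : g ∈ frobLift p S
        · obtain ⟨a, b, hab⟩ := mem_frobLift_iff.1 hfp
          obtain ⟨c, d, hcd⟩ := mem_frobLift_iff.1 hgp
          obtain ⟨x, hx, hpx, hxA⟩ := h.not_saturated_of_pow_add hp hpK hpS.not_isUnit hab hcd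
          exact absurd (hsat x hx hpx) hxA
        · refine Or.inr ⟨hgp, hprimeμ hgp, hnecessary h.swap ?_ _⟩
          rwa [Set.pair_comm]
      · exact Or.inl ⟨hfp, hprimeω hfp, hnecessary h hsat _⟩
    · rintro (⟨hfp, hprime, hmem⟩ | ⟨hgp, hprime, hmem⟩) x hx hpx
      · rw [algebraMap_mem_powWedge_iff hp] at hmem
        exact h.saturated hp hpS hfp hmem hx hpx
      · rw [algebraMap_mem_powWedge_iff hp] at hmem
        rw [Set.pair_comm] at hpx ⊢
        exact h.swap.saturated hp hpS hgp hmem hx hpx
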